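/- Let $\mathbb R^4_1$ be $\mathbb R^4$ with the metric $\langle x,y\rangle=x_1y_1+x_2y_2+x_3y_3-x_4y_4$, and let $M$ be a connected Riemann surface. An immersed minimal surface $X:M\to\mathbb R^3$ is a smooth conformal immersion with zero mean curvature; an immersed stationary surface $\widetilde X:M\to\mathbb R^4_1$ is a smooth conformal spacelike immersion whose mean curvature vector vanishes. Either is called complete if its induced metric is complete. Write $X_z\,dz$ for the holomorphic $(1,0)$-part of $dX$. The Gauss maps $\phi,\psi:M\to\mathbb C\cup\{\infty\}$ of a stationary surface $\widetilde X$ are given by $\widetilde X_z\,dz=(\phi+\psi,\,-i(\phi-\psi),\,1-\phi\psi,\,1+\phi\psi)\,dh$, that is, by $\phi=\frac{\Theta_1+i\Theta_2}{\Theta_3+\Theta_4}$, $\psi=\frac{\Theta_1-i\Theta_2}{\Theta_3+\Theta_4}$ for $\widetilde X_z\,dz=(\Theta_1,\Theta_2,\Theta_3,\Theta_4)$; where these quotients are $0/0$, one uses the equal quotients $\phi=\frac{\Theta_4-\Theta_3}{\Theta_1-i\Theta_2}$, $\psi=\frac{\Theta_4-\Theta_3}{\Theta_1+i\Theta_2}$.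 A stationary surface has regular ends if there is no sequence in $M$ leaving every compact subset along which $\phi$ and $\bar\psi$ converge to the same point of $\mathbb C\cup\{\infty\}$ (if $M$ is a compact surface minus finitely many points to which $\phi,\psi$ extend, this means $\phi\ne\bar\psi$ at each of these points). It is fully immersed if its image lies in no $3$-dimensional affine subspace of $\mathbb R^4_1$. For an immersed minimal surface $X:M\to\mathbb R^3$ with $X_z\,dz=(\Theta_1,\Theta_2,\Theta_3)$ and $\zeta\in\mathbb C\setminus\{0\}$, a Lorentz deformation of $X$ with parameter $\zeta$ is a smooth map $\widetilde X:M\to\mathbb R^4_1$ with $$\widetilde X_z\,dz=(\Theta_1,\Theta_2,a\Theta_3,b\Theta_3),\qquad a=\frac{\zeta+\zeta^{-1}}2,\quad b=\frac{\zeta-\zeta^{-1}}2 .$$ (1) Let $X:M\to\mathbb R^3$ be a complete immersed minimal surface without real or imaginary vertical periods, i.e. $\int_\gamma\Theta_3=0$ for every closed curve $\gamma$ in $M$. Let $\zeta\in\mathbb C\setminus\{0\}$ be not purely imaginary. Then a Lorentz deformation $\widetilde X:M\to\mathbb R^4_1$ of $X$ with parameter $\zeta$ exists, and every such $\widetilde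 X$ is a complete immersed stationary surface with regular ends. If moreover $\zeta$ is not real and $X(M)$ is not contained in a plane, then $\widetilde X$ is fully immersed. (2) Conversely, let $\widetilde X:M\to\mathbb R^4_1$ be a fully immersed stationary surface (not necessarily complete) with $\phi\psi\equiv-1/\zeta^2$ for some constant $\zeta\in\mathbb C\setminus\{0\}$. Then $\zeta$ is not purely imaginary, and $\widetilde X$ is the Lorentz deformation with parameter $\zeta$ of an immersed minimal surface $X:M\to\mathbb R^3$ without real or imaginary vertical periods. -/

import Mathlib

open scoped Manifold ContDiff Topology
open Filter MeasureTheory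

/-- The flat metric `∑ i, ε i * x i * y i` on `ℝⁿ` with signs `ε`. -/
def flatForm {n : ℕ} (ε : Fin n → ℝ) (x y : Fin n → ℝ) : ℝ := ∑ i, ε i * x i * y i

/-- The signs of Euclidean `3`-space. -/
def euclideanSign : Fin 3 → ℝ := ![1, 1, 1]

/-- The signs of the Lorentz space `ℝ⁴₁`; the last coordinate is timelike. -/
def lorentzSign : Fin 4 → ℝ := ![1, 1, 1, -1]

/-- The Riemann sphere `ℂ ∪ {∞}`. -/
abbrev RiemannSphere := OnePoint ℂ

open Classical in
/-- The point of the Riemann sphere with homogeneous coordinates `[u : v] ≠ [0 : 0]`. -/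
noncomputable def sphereRatio (u v : ℂ) : RiemannSphere :=
  if v = 0 then OnePoint.infty else ((u / v : ℂ) : OnePoint ℂ)

/-- The map `w ↦ c / w` of the Riemann sphere (for `c ≠ 0`), exchanging `0` and `∞`. -/
noncomputable def sphereDiv (c : ℂ) : RiemannSphere → RiemannSphere
  | OnePoint.infty => ((0 : ℂ) : OnePoint ℂ)
  | OnePoint.some w => sphereRatio c w

/-- Complex conjugation on the Riemann sphere. -/
def sphereConj : RiemannSphere → RiemannSphere := OnePoint.map (starRingEnd ℂ)

section Surfaces

variable {M : Type*} [TopologicalSpace M] [ChartedSpace ℂ M] {n : ℕ}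

/-- The real differential of `X : M → ℝⁿ` at `p`. The tangent space of the Riemann surface `M` at
`p` is `ℂ`, and its complex structure is multiplication by `Complex.I`. -/
noncomputable def surfaceDiff (X : M → Fin n → ℝ) (p : M) (v : ℂ) : Fin n → ℝ :=
  mfderiv 𝓘(ℝ, ℂ) 𝓘(ℝ, Fin n → ℝ) X p v

/-- The `ℂⁿ`-valued `(1,0)`-form `X_z dz = ∂X`, evaluated at the tangent vector `v` at `p`:
`X_z dz (v) = (dX (v) - i dX (i v)) / 2`. -/
noncomputable def delForm (X : M → Fin n → ℝ) (p : M) (v : ℂ) : Fin n → ℂ := fun i =>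
  ((surfaceDiff X p v i : ℂ) - Complex.I * (surfaceDiff X p (Complex.I * v) i : ℂ)) / 2

/-- The mean curvature vector of a conformal immersion at the point with coordinate `z` in the
chart `e`: in a conformal coordinate `z = x + i y` with induced metric `lam (dx² + dy²)` it is
`(X_xx + X_yy) / (2 lam)`. -/
noncomputable def meanCurvatureVector (ε : Fin n → ℝ) (X : M → Fin n → ℝ)
    (e : OpenPartialHomeomorph M ℂ) (z : ℂ) : Fin n → ℝ :=
  (2 * flatForm ε (fderiv ℝ (X ∘ e.symm) z 1) (fderiv ℝ (X ∘ e.symm) z 1))⁻¹ •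
    Laplacian.laplacian (X ∘ e.symm) z

/-- Smooth conformal spacelike immersions of a Riemann surface `M` in the flat space with signs `ε`
whose mean curvature vector vanishes. For the Euclidean signs these are the immersed minimal
surfaces in `ℝ³`, for the Lorentz signs the (immersed) stationary surfaces in `ℝ⁴₁`. -/
structure IsZeroMeanCurvatureSurface (ε : Fin n → ℝ) (X : M → Fin n → ℝ) : Prop where
  smooth : ContMDiff 𝓘(ℝ, ℂ) 𝓘(ℝ, Fin n → ℝ) ∞ X
  spacelike : ∀ (p : M) (v : ℂ), v ≠ 0 → 0 < flatForm ε (surfaceDiff X p v) (surfaceDiff X p v)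
  conformal_norm : ∀ (p : M) (v : ℂ),
    flatForm ε (surfaceDiff X p (Complex.I * v)) (surfaceDiff X p (Complex.I * v)) =
      flatForm ε (surfaceDiff X p v) (surfaceDiff X p v)
  conformal_orth : ∀ (p : M) (v : ℂ),
    flatForm ε (surfaceDiff X p v) (surfaceDiff X p (Complex.I * v)) = 0
  meanCurvature_eq_zero : ∀ e ∈ atlas ℂ M, ∀ z ∈ e.target, meanCurvatureVector ε X e z = 0

/-- Immersed minimal surfaces in `ℝ³`. -/
abbrev IsMinimalSurface (X : M → Fin 3 → ℝ) : Prop := IsZeroMeanCurvatureSurface euclideanSign X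

/-- Immersed stationary surfaces in `ℝ⁴₁`. -/
abbrev IsStationarySurface (X : M → Fin 4 → ℝ) : Prop := IsZeroMeanCurvatureSurface lorentzSign X

/-- The velocity of a curve in `M`. -/
noncomputable def velocity (γ : ℝ → M) (t : ℝ) : ℂ :=
  mfderiv 𝓘(ℝ, ℝ) 𝓘(ℝ, ℂ) γ t (1 : ℝ)

/-- Completeness of the induced metric: every `C¹` curve `[0, ∞) → M` that leaves every compact
subset of `M` has infinite length. -/
def IsCompleteSurface (ε : Fin n → ℝ) (X : M → Fin n → ℝ) : Prop :=
  ∀ γ : ℝ → M, ContMDiffOn 𝓘(ℝ, ℝ) 𝓘(ℝ, ℂ) 1 γ (Set.Ici 0) → Tendsto γ atTop (cocompact M) →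
    ∫⁻ t in Set.Ici (0 : ℝ), ENNReal.ofReal
      (√(flatForm ε (surfaceDiff X (γ t) (velocity γ t)) (surfaceDiff X (γ t) (velocity γ t)))) = ⊤

/-- `X : M → ℝⁿ` is full: its image lies in no affine hyperplane of `ℝⁿ` (no affine plane for
`n = 3`, no `3`-dimensional affine subspace for `n = 4`). -/
def IsFull (X : M → Fin n → ℝ) : Prop :=
  ∀ E : AffineSubspace ℝ (Fin n → ℝ), Module.finrank ℝ E.direction + 1 = n → ¬ ∀ p, X p ∈ E

/-- Piecewise `C¹` closed curves `[0, 1] → M`. -/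
def IsPiecewiseC1Loop (γ : ℝ → M) : Prop :=
  γ 0 = γ 1 ∧ ∃ (N : ℕ) (τ : ℕ → ℝ), Monotone τ ∧ τ 0 = 0 ∧ τ N = 1 ∧
    ∀ k < N, ContMDiffOn 𝓘(ℝ, ℝ) 𝓘(ℝ, ℂ) 1 γ (Set.Icc (τ k) (τ (k + 1)))

/-- `X : M → ℝ³` has neither real nor imaginary vertical periods: the third component of `X_z dz`
(twice the height differential) integrates to zero along every closed curve. -/
def HasNoVerticalPeriods (X : M → Fin 3 → ℝ) : Prop :=
  ∀ γ : ℝ → M, IsPiecewiseC1Loop γ → ∫ t in (0 : ℝ)..1, delForm X (γ t) (velocity γ t) 2 = 0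

open Classical in
/-- The Gauss map `φ` of a stationary surface in `ℝ⁴₁`. Write `X_z dz = (Θ₁, Θ₂, Θ₃, Θ₄)`; the
matrix with rows `(Θ₄ - Θ₃, Θ₁ + iΘ₂)` and `(Θ₁ - iΘ₂, Θ₃ + Θ₄)` has rank one, being
`2 (φ, 1)ᵀ (ψ, 1) dh` for `X_z dz = (φ + ψ, -i(φ - ψ), 1 - φψ, 1 + φψ) dh`, and `φ` is the ratio of
the entries of either nonzero column. -/
noncomputable def gaussPhi (X : M → Fin 4 → ℝ) (p : M) : RiemannSphere :=
  let θ := delForm X p 1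
  if θ 0 + Complex.I * θ 1 = 0 ∧ θ 2 + θ 3 = 0 then
    sphereRatio (θ 3 - θ 2) (θ 0 - Complex.I * θ 1)
  else sphereRatio (θ 0 + Complex.I * θ 1) (θ 2 + θ 3)

open Classical in
/-- The Gauss map `ψ` of a stationary surface in `ℝ⁴₁`: the ratio of the entries of either nonzero
row of the matrix in the description of `gaussPhi`. -/
noncomputable def gaussPsi (X : M → Fin 4 → ℝ) (p : M) : RiemannSphere :=
  let θ := delForm X p 1
  if θ 0 - Complex.I * θ 1 = 0 ∧ θ 2 + θ 3 = 0 then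
    sphereRatio (θ 3 - θ 2) (θ 0 + Complex.I * θ 1)
  else sphereRatio (θ 0 - Complex.I * θ 1) (θ 2 + θ 3)

/-- All ends are regular: `φ` and the conjugate of `ψ` (that is, the two lightlike normal
directions) do not tend to the same point of the Riemann sphere along any sequence going to an
end of `M`, i.e. leaving every compact set. If `M` is a closed surface punctured at finitely many
points to which `φ` and `ψ` extend, this says that `φ` differs from the conjugate of `ψ` at every
puncture. -/
def HasRegularEnds (X : M → Fin 4 → ℝ) : Prop :=
  ∀ (u : ℕ → M) (a b : RiemannSphere), Tendsto u atTop (cocompact M) →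
    Tendsto (fun k => gaussPhi X (u k)) atTop (𝓝 a) →
    Tendsto (fun k => sphereConj (gaussPsi X (u k))) atTop (𝓝 b) → a ≠ b

/-- `Y : M → ℝ⁴₁` is the Lorentz deformation with parameter `ζ` of `X : M → ℝ³` (unique up to
translations): `Y_z dz = (Θ₁, Θ₂, a Θ₃, b Θ₃)` where `X_z dz = (Θ₁, Θ₂, Θ₃)`,
`a = (ζ + ζ⁻¹) / 2` and `b = (ζ - ζ⁻¹) / 2`. -/
def IsLorentzDeformation (ζ : ℂ) (X : M → Fin 3 → ℝ) (Y : M → Fin 4 → ℝ) : Prop :=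
  ContMDiff 𝓘(ℝ, ℂ) 𝓘(ℝ, Fin 4 → ℝ) ∞ Y ∧
  ∀ (p : M) (v : ℂ), delForm Y p v =
    ![delForm X p v 0, delForm X p v 1,
      (ζ + ζ⁻¹) / 2 * delForm X p v 2, (ζ - ζ⁻¹) / 2 * delForm X p v 2]

end Surfaces

/-! ### Real calculus on a Riemann surface -/

section Calculus

variable {M : Type*} [TopologicalSpace M] [ChartedSpace ℂ M]

/-! Write θ for ∂X evaluated at the tangent vector 1. Conformality says that the complex square ∑ ε
θ² vanishes, and the induced metric is then 2|v|² ∑ ε |θ|², so everything is algebra in θ plus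
harmonicity of the coordinates. Since a² - b² = 1, the deformation keeps the complex square. With k
= (Re ζ)² / |ζ|² one has |a|² - |b|² = 2k - 1, and conformality gives |θ₃|² ≤ |θ₁|² + |θ₂|², so the
new metric is at least k times the old one (`IsLorentzDeformation.mul_delNormSq_le`). This gives
both the spacelike condition and completeness. A deformation exists because a period-free Θ₃ has a
global primitive G, and 2 Re(aG), 2 Re(bG) serve as the last two coordinates.

The product of the Gauss maps is (b - a)/(b + a) = -1/ζ². A common limit w of φ and the conjugate of
ψ would satisfy |w|²ζ² = -1, which is impossible for Re ζ ≠ 0.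

For fullness, a real linear relation on ∂Y becomes c₀θ₁ + c₁θ₂ + μθ₃ = 0. If c₀ = c₁ = 0, then μ =
0, and the relation is trivial because ζ² is not real. Otherwise the relation cuts the conic θ₁² +
θ₂² + θ₃² = 0 in at most two points, so by connectedness the direction of θ is constant and X is
planar (`IsMinimalSurface.not_isFull_of_relation`).

Conversely, a constant Gauss map product is a linear relation between Θ₃ and Θ₄. It would be real if
ζ² were, so fullness forces Im ζ² ≠ 0. Then (Θ₃, Θ₄) = (a, b)t, and a primitive of t is an explicit
complex linear combination of the last two real coordinates of Y (`exists_minimal_of_relation`).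
Having a global primitive, t has no periods. -/

/-- The real derivative of a vector-valued map on a Riemann surface. -/
noncomputable def realDeriv {E : Type*} [NormedAddCommGroup E] [NormedSpace ℝ E]
    (f : M → E) (p : M) : ℂ →L[ℝ] E :=
  mfderiv 𝓘(ℝ, ℂ) 𝓘(ℝ, E) f p

/-- The derivative of the inverse of a chart `e`, read in the preferred chart of the image. -/
noncomputable def chartDeriv (e : OpenPartialHomeomorph M ℂ) (z : ℂ) : ℂ →L[ℂ] ℂ :=
  mfderiv 𝓘(ℂ) 𝓘(ℂ) e.symm z

/-- The complex number by which `chartDeriv e z` multiplies. -/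
noncomputable def chartFactor (e : OpenPartialHomeomorph M ℂ) (z : ℂ) : ℂ := chartDeriv e z 1

theorem HasMFDerivAt.restrictScalars_complex {N N' : Type*} [TopologicalSpace N]
    [ChartedSpace ℂ N] [TopologicalSpace N'] [ChartedSpace ℂ N'] {f : N → N'} {x : N}
    {D : ℂ →L[ℂ] ℂ} (h : HasMFDerivAt 𝓘(ℂ) 𝓘(ℂ) f x D) :
    HasMFDerivAt 𝓘(ℝ, ℂ) 𝓘(ℝ, ℂ) f x (D.restrictScalars ℝ) :=
  ⟨h.1, HasFDerivWithinAt.restrictScalars ℝ h.2⟩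

theorem isManifold_real (M : Type*) [TopologicalSpace M] [ChartedSpace ℂ M]
    [IsManifold 𝓘(ℂ) ω M] : IsManifold 𝓘(ℝ, ℂ) ∞ M := by
  refine isManifold_of_contDiffOn _ _ _ fun e e' he he' => ?_
  have h := ((contDiffGroupoid ω 𝓘(ℂ)).compatible he he').1
  exact (h.restrict_scalars ℝ).of_le le_top

variable {E : Type*} [NormedAddCommGroup E] [NormedSpace ℝ E]

theorem realDeriv_clm_comp {F : Type*} [NormedAddCommGroup F] [NormedSpace ℝ F] (L : E →L[ℝ] F)
    {f : M → E} {p : M} (hf : MDifferentiableAt 𝓘(ℝ, ℂ) 𝓘(ℝ, E) f p) (v : ℂ) :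
    realDeriv (fun q => L (f q)) p v = L (realDeriv f p v) := by
  have h := (HasMFDerivAt.comp p L.hasMFDerivAt hf.hasMFDerivAt).mfderiv
  exact DFunLike.congr_fun h v

variable [IsManifold 𝓘(ℂ) ω M]

theorem hasMFDerivAt_chart_symm {e : OpenPartialHomeomorph M ℂ} (he : e ∈ atlas ℂ M) {z : ℂ}
    (hz : z ∈ e.target) :
    HasMFDerivAt 𝓘(ℂ) 𝓘(ℂ) e.symm z (chartDeriv e z) :=
  have : IsManifold 𝓘(ℂ) 1 M := IsManifold.of_le (n := ω) le_top
  (mdifferentiableAt_atlas_symm he hz).hasMFDerivAt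

theorem chartFactor_ne_zero {e : OpenPartialHomeomorph M ℂ} (he : e ∈ atlas ℂ M) {z : ℂ}
    (hz : z ∈ e.target) : chartFactor e z ≠ 0 := by
  have : IsManifold 𝓘(ℂ) 1 M := IsManifold.of_le (n := ω) le_top
  intro h
  have h1 := (mdifferentiable_of_mem_atlas (I := 𝓘(ℂ)) he).comp_symm_deriv hz
  obtain ⟨D, hD⟩ : ∃ D : ℂ →L[ℂ] ℂ, D (chartFactor e z) = 1 :=
    ⟨mfderiv 𝓘(ℂ) 𝓘(ℂ) e (e.symm z), DFunLike.congr_fun h1 (1 : ℂ)⟩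
  rw [h, map_zero] at hD
  exact zero_ne_one hD

/-- Tangent vectors are read in the preferred chart at each point, which varies with the point. The
factor converts them to the coordinate of one fixed chart. -/
theorem realDeriv_chartFactor_mul {e : OpenPartialHomeomorph M ℂ} (he : e ∈ atlas ℂ M) {z : ℂ}
    (hz : z ∈ e.target) {f : M → E} (hf : MDifferentiableAt 𝓘(ℝ, ℂ) 𝓘(ℝ, E) f (e.symm z))
    (v : ℂ) :
    realDeriv f (e.symm z) (chartFactor e z * v) = fderiv ℝ (f ∘ e.symm) z v := by
  have h1 := (hasMFDerivAt_chart_symm he hz).restrictScalars_complex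
  have h2 := (HasMFDerivAt.comp z hf.hasMFDerivAt h1).mfderiv
  rw [mfderiv_eq_fderiv] at h2
  rw [h2]
  change realDeriv f (e.symm z) (chartFactor e z * v) = realDeriv f (e.symm z) (chartDeriv e z v)
  have : chartDeriv e z v = v * chartFactor e z := by
    simpa [chartFactor] using (chartDeriv e z).map_smul v 1
  rw [this, mul_comm]

theorem realDeriv_eq_fderiv {e : OpenPartialHomeomorph M ℂ} (he : e ∈ atlas ℂ M) {z : ℂ}
    (hz : z ∈ e.target) {f : M → E} (hf : MDifferentiableAt 𝓘(ℝ, ℂ) 𝓘(ℝ, E) f (e.symm z))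
    (v : ℂ) :
    realDeriv f (e.symm z) v = fderiv ℝ (f ∘ e.symm) z ((chartFactor e z)⁻¹ * v) := by
  rw [← realDeriv_chartFactor_mul he hz hf, mul_inv_cancel_left₀ (chartFactor_ne_zero he hz)]

theorem ContMDiffAt.comp_chart_symm {e : OpenPartialHomeomorph M ℂ} (he : e ∈ atlas ℂ M) {z : ℂ}
    (hz : z ∈ e.target) {f : M → E} (hf : ContMDiffAt 𝓘(ℝ, ℂ) 𝓘(ℝ, E) ∞ f (e.symm z)) :
    ContDiffAt ℝ ∞ (f ∘ e.symm) z := by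
  have := isManifold_real M
  rw [← contMDiffAt_iff_contDiffAt]
  exact hf.comp z ((contMDiffOn_symm_of_mem_maximalAtlas
    (IsManifold.subset_maximalAtlas he)).contMDiffAt (e.open_target.mem_nhds hz))

/-- A map on a connected Riemann surface with vanishing derivative is constant. -/
theorem eq_of_realDeriv_eq_zero [PreconnectedSpace M] {f : M → E}
    (hf : ∀ p, MDifferentiableAt 𝓘(ℝ, ℂ) 𝓘(ℝ, E) f p) (h0 : ∀ p v, realDeriv f p v = 0)
    (p q : M) : f p = f q := by
  refine (IsLocallyConstant.iff_eventually_eq f).2 (fun x => ?_) |>.apply_eq_of_preconnectedSpace p q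
  set e := chartAt ℂ x
  have he : e ∈ atlas ℂ M := chart_mem_atlas ℂ x
  have hx : x ∈ e.source := mem_chart_source ℂ x
  obtain ⟨r, hr, hB⟩ := Metric.isOpen_iff.1 e.open_target _ (e.map_source hx)
  have hfd : ∀ z ∈ Metric.ball (e x) r, HasFDerivAt (f ∘ e.symm) (fderiv ℝ (f ∘ e.symm) z) z := by
    intro z hz
    have h1 := (hasMFDerivAt_chart_symm he (hB hz)).restrictScalars_complex
    have h2 := (HasMFDerivAt.comp z (hf (e.symm z)).hasMFDerivAt h1).mdifferentiableAt
    exact (mdifferentiableAt_iff_differentiableAt.1 h2).hasFDerivAt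
  have hU : e.source ∩ e ⁻¹' Metric.ball (e x) r ∈ 𝓝 x :=
    (e.isOpen_inter_preimage Metric.isOpen_ball).mem_nhds ⟨hx, Metric.mem_ball_self hr⟩
  filter_upwards [hU] with y hy
  have := Metric.isOpen_ball.is_const_of_fderiv_eq_zero (𝕜 := ℝ) (f := f ∘ e.symm)
    (convex_ball (e x) r).isPreconnected
    (fun z hz => (hfd z hz).differentiableAt.differentiableWithinAt)
    (fun z hz => by
      ext v
      rw [← realDeriv_chartFactor_mul he (hB hz) (hf _), h0]; rfl)
    hy.2 (Metric.mem_ball_self hr)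
  simpa [e.left_inv hy.1, e.left_inv hx] using this

end Calculus

/-! ### Linear algebra of the form `∂X` -/

section DelForm

variable {M : Type*} [TopologicalSpace M] [ChartedSpace ℂ M] {n : ℕ}

theorem surfaceDiff_eq_realDeriv (X : M → Fin n → ℝ) (p : M) (v : ℂ) :
    surfaceDiff X p v = realDeriv X p v := rfl

theorem surfaceDiff_apply {X : M → Fin n → ℝ} {p : M}
    (hX : MDifferentiableAt 𝓘(ℝ, ℂ) 𝓘(ℝ, Fin n → ℝ) X p) (v : ℂ) (i : Fin n) :
    surfaceDiff X p v i = realDeriv (fun q => X q i) p v :=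
  (realDeriv_clm_comp (ContinuousLinearMap.proj (R := ℝ) (φ := fun _ : Fin n => ℝ) i) hX v).symm

theorem surfaceDiff_eq_add (X : M → Fin n → ℝ) (p : M) (v : ℂ) :
    surfaceDiff X p v = v.re • surfaceDiff X p 1 + v.im • surfaceDiff X p Complex.I := by
  simp only [surfaceDiff_eq_realDeriv, ← map_smul, ← map_add]
  congr 1
  apply Complex.ext <;> simp

theorem delForm_eq_mul (X : M → Fin n → ℝ) (p : M) (v : ℂ) (i : Fin n) :
    delForm X p v i = v * delForm X p 1 i := by
  unfold delForm
  rw [surfaceDiff_eq_add X p v, surfaceDiff_eq_add X p (Complex.I * v)]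
  apply Complex.ext <;> simp <;> ring

theorem surfaceDiff_eq_re (X : M → Fin n → ℝ) (p : M) (v : ℂ) (i : Fin n) :
    surfaceDiff X p v i = 2 * (v * delForm X p 1 i).re := by
  rw [← delForm_eq_mul]
  unfold delForm
  simp
  ring

theorem delForm_eq_of_re {X : M → Fin n → ℝ} {p : M} {i : Fin n} {t : ℂ}
    (h : ∀ v, surfaceDiff X p v i = 2 * (v * t).re) (v : ℂ) : delForm X p v i = v * t := by
  unfold delForm
  rw [h, h]
  apply Complex.ext <;> simp; ring

/-- The complex square `∑ ε i θ i ^ 2` of `θ = ∂X (1)`. -/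
noncomputable def delSq (ε : Fin n → ℝ) (X : M → Fin n → ℝ) (p : M) : ℂ :=
  ∑ i, (ε i : ℂ) * delForm X p 1 i ^ 2

/-- The hermitian square `∑ ε i |θ i| ^ 2` of `θ = ∂X (1)`. -/
noncomputable def delNormSq (ε : Fin n → ℝ) (X : M → Fin n → ℝ) (p : M) : ℝ :=
  ∑ i, ε i * Complex.normSq (delForm X p 1 i)

/-- Polarizing dX(v) = 2 Re(vθ) shows that two numbers determine the metric at a point: the complex
square, which measures the failure of conformality, and the hermitian square, which is the conformal
factor. -/
theorem flatForm_surfaceDiff (ε : Fin n → ℝ) (X : M → Fin n → ℝ) (p : M) (v w : ℂ) :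
    flatForm ε (surfaceDiff X p v) (surfaceDiff X p w) =
      2 * ((v * w * delSq ε X p).re + (v * (starRingEnd ℂ) w).re * delNormSq ε X p) := by
  unfold flatForm delSq delNormSq
  simp only [surfaceDiff_eq_re, Finset.mul_sum, Complex.re_sum, ← Finset.sum_add_distrib]
  refine Finset.sum_congr rfl fun i _ => ?_
  simp [Complex.normSq_apply, pow_two]
  ring

theorem delSq_eq_zero {ε : Fin n → ℝ} {X : M → Fin n → ℝ} (h : IsZeroMeanCurvatureSurface ε X)
    (p : M) : delSq ε X p = 0 := by
  have h1 := h.conformal_norm p 1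
  have h2 := h.conformal_orth p 1
  rw [flatForm_surfaceDiff] at h2
  rw [flatForm_surfaceDiff, flatForm_surfaceDiff] at h1
  simp at h1 h2
  apply Complex.ext <;> simp <;> linarith

theorem delNormSq_pos {ε : Fin n → ℝ} {X : M → Fin n → ℝ} (h : IsZeroMeanCurvatureSurface ε X)
    (p : M) : 0 < delNormSq ε X p := by
  have h1 := h.spacelike p 1 one_ne_zero
  rw [flatForm_surfaceDiff, delSq_eq_zero h] at h1
  simp at h1
  linarith

theorem flatForm_surfaceDiff_self {ε : Fin n → ℝ} {X : M → Fin n → ℝ}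
    {p : M} (h : delSq ε X p = 0) (v : ℂ) :
    flatForm ε (surfaceDiff X p v) (surfaceDiff X p v) =
      2 * (Complex.normSq v * delNormSq ε X p) := by
  rw [flatForm_surfaceDiff, h, Complex.mul_conj]
  simp

end DelForm

/-! ### Harmonicity of the coordinate functions -/

section Laplace

open Laplacian InnerProductSpace

/-- If `du = dw ∘ c` for a complex constant `c` and `w` is harmonic, then so is `u`. -/
theorem laplacian_eq_zero_of_fderiv_eq {u w : ℂ → ℝ} {c z : ℂ} (hw : ContDiffAt ℝ 2 w z)
    (h : ∀ᶠ x in 𝓝 z, ∀ v, fderiv ℝ u x v = fderiv ℝ w x (c * v)) (h0 : Δ w z = 0) :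
    Δ u z = 0 := by
  have hD : DifferentiableAt ℝ (fderiv ℝ w) z :=
    (hw.fderiv_right (m := 1) (by norm_num)).differentiableAt (by norm_num)
  let C : ℂ →L[ℝ] ℂ := ContinuousLinearMap.mul ℝ ℂ c
  have h1 : fderiv ℝ u =ᶠ[𝓝 z] fun x => (fderiv ℝ w x).comp C := by
    filter_upwards [h] with x hx
    ext v; simp [hx, C]
  have h2 : ∀ v v', fderiv ℝ (fderiv ℝ u) z v v' = fderiv ℝ (fderiv ℝ w) z v (c * v') := by
    intro v v'
    rw [h1.fderiv_eq]
    have := (hD.hasFDerivAt.clm_comp (hasFDerivAt_const C z)).fderiv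
    rw [this]
    simp [C]
  have hsymm := hw.isSymmSndFDerivAt (by simp)
  rw [laplacian_eq_iteratedFDeriv_complexPlane] at h0 ⊢
  simp only [iteratedFDeriv_two_apply, Matrix.cons_val_zero, Matrix.cons_val_one] at h0 ⊢
  -- With B the Hessian of w, the claim is B(1, c) + B(i, ci) = 0. The Re c part is the Laplacian of
  -- w, and the Im c part cancels by symmetry of B.
  rw [h2, h2]
  set B := fderiv ℝ (fderiv ℝ w) z
  have e1 : c * 1 = c.re • (1 : ℂ) + c.im • Complex.I := by apply Complex.ext <;> simp
  have e2 : c * Complex.I = c.re • Complex.I - c.im • (1 : ℂ) := by apply Complex.ext <;> simp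
  rw [e1, e2, map_add, map_sub, map_smul, map_smul, map_smul, map_smul, hsymm 1 Complex.I]
  simp only [smul_eq_mul]
  linear_combination c.re * h0

end Laplace

section Surfaces

open Laplacian InnerProductSpace

variable {M : Type*} [TopologicalSpace M] [ChartedSpace ℂ M] {n : ℕ}

theorem ContMDiff.component {X : M → Fin n → ℝ}
    (hX : ContMDiff 𝓘(ℝ, ℂ) 𝓘(ℝ, Fin n → ℝ) ∞ X) (i : Fin n) :
    ContMDiff 𝓘(ℝ, ℂ) 𝓘(ℝ, ℝ) ∞ (fun p => X p i) :=
  contMDiff_pi_space.1 hX i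

variable [IsManifold 𝓘(ℂ) ω M]

theorem laplacian_chart_component {X : M → Fin n → ℝ}
    (hX : ContMDiff 𝓘(ℝ, ℂ) 𝓘(ℝ, Fin n → ℝ) ∞ X)
    {e : OpenPartialHomeomorph M ℂ} (he : e ∈ atlas ℂ M) {z : ℂ} (hz : z ∈ e.target) (i : Fin n) :
    Δ ((fun p => X p i) ∘ e.symm) z = Δ (X ∘ e.symm) z i := by
  have h := (ContMDiffAt.comp_chart_symm he hz hX.contMDiffAt).of_le
    (m := 2) (ENat.LEInfty.out)
  exact ContDiffAt.laplacian_CLM_comp_left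
    (l := ContinuousLinearMap.proj (R := ℝ) (φ := fun _ : Fin n => ℝ) i) h

theorem IsZeroMeanCurvatureSurface.laplacian_eq_zero {ε : Fin n → ℝ} {X : M → Fin n → ℝ}
    (h : IsZeroMeanCurvatureSurface ε X) {e : OpenPartialHomeomorph M ℂ} (he : e ∈ atlas ℂ M)
    {z : ℂ} (hz : z ∈ e.target) (i : Fin n) :
    Δ ((fun p => X p i) ∘ e.symm) z = 0 := by
  rw [laplacian_chart_component h.smooth he hz]
  have h1 := h.meanCurvature_eq_zero e he z hz
  unfold meanCurvatureVector at h1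
  rw [← realDeriv_chartFactor_mul he hz (h.smooth.mdifferentiableAt (by simp)),
    ← surfaceDiff_eq_realDeriv, mul_one] at h1
  -- The scalar in the mean curvature vector is an inverse, equal to 0 by convention for a null
  -- vector; spacelikeness excludes that case.
  have h2 := h.spacelike (e.symm z) _ (chartFactor_ne_zero he hz)
  rcases smul_eq_zero.1 h1 with h3 | h3
  · rw [inv_eq_zero] at h3
    linarith
  · rw [h3]; rfl

theorem isZeroMeanCurvatureSurface_of_delForm {ε : Fin n → ℝ} {X : M → Fin n → ℝ}
    (hX : ContMDiff 𝓘(ℝ, ℂ) 𝓘(ℝ, Fin n → ℝ) ∞ X) (hQ : ∀ p, delSq ε X p = 0)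
    (hN : ∀ p, 0 < delNormSq ε X p)
    (hL : ∀ e ∈ atlas ℂ M, ∀ z ∈ e.target, ∀ i, Δ ((fun p => X p i) ∘ e.symm) z = 0) :
    IsZeroMeanCurvatureSurface ε X where
  smooth := hX
  spacelike p v hv := by
    rw [flatForm_surfaceDiff_self (hQ p)]
    have := Complex.normSq_pos.2 hv
    have := hN p
    positivity
  conformal_norm p v := by
    simp [flatForm_surfaceDiff_self (hQ p)]
  conformal_orth p v := by
    rw [flatForm_surfaceDiff, hQ]
    simp
    left
    ring
  meanCurvature_eq_zero e he z hz := by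
    unfold meanCurvatureVector
    have : Δ (X ∘ e.symm) z = 0 := by
      funext i
      rw [← laplacian_chart_component hX he hz, hL e he z hz]
      rfl
    rw [this, smul_zero]

theorem laplacian_chart_eq_zero_of_realDeriv_eq {f g : M → ℝ} {c : ℂ}
    (hf : ContMDiff 𝓘(ℝ, ℂ) 𝓘(ℝ, ℝ) ∞ f) (hg : ContMDiff 𝓘(ℝ, ℂ) 𝓘(ℝ, ℝ) ∞ g)
    (h : ∀ p v, realDeriv f p v = realDeriv g p (c * v))
    {e : OpenPartialHomeomorph M ℂ} (he : e ∈ atlas ℂ M) {z : ℂ} (hz : z ∈ e.target)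
    (h0 : Δ (g ∘ e.symm) z = 0) : Δ (f ∘ e.symm) z = 0 := by
  refine laplacian_eq_zero_of_fderiv_eq (c := c) ((ContMDiffAt.comp_chart_symm he hz
    hg.contMDiffAt).of_le (ENat.LEInfty.out)) ?_ h0
  filter_upwards [e.open_target.mem_nhds hz] with x hx v
  rw [← realDeriv_chartFactor_mul he hx (hf.mdifferentiableAt (by simp)),
    ← realDeriv_chartFactor_mul he hx (hg.mdifferentiableAt (by simp)), h]
  ring_nf

end Surfaces

/-! ### Fullness -/

section Full

variable {M : Type*} [TopologicalSpace M] [ChartedSpace ℂ M] {n : ℕ}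

theorem continuousLinearMap_surfaceDiff (L : (Fin n → ℝ) →L[ℝ] ℝ) (X : M → Fin n → ℝ) (p : M)
    (v : ℂ) : L (surfaceDiff X p v) =
      2 * (v * ∑ i, (L (Pi.single i 1) : ℂ) * delForm X p 1 i).re := by
  have h : L (surfaceDiff X p v) = ∑ i, surfaceDiff X p v i * L (Pi.single i 1) := by
    conv_lhs => rw [pi_eq_sum_univ' (surfaceDiff X p v), map_sum]
    simp
  rw [h, Finset.mul_sum, Complex.re_sum, Finset.mul_sum]
  refine Finset.sum_congr rfl fun i _ => ?_
  rw [surfaceDiff_eq_re]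
  simp
  ring

/-- A surface with a linear relation between the components of `∂X` is not full. -/
theorem IsFull.sum_ne_zero [IsManifold 𝓘(ℂ) ω M] [ConnectedSpace M] {X : M → Fin n → ℝ}
    (hX : ContMDiff 𝓘(ℝ, ℂ) 𝓘(ℝ, Fin n → ℝ) ∞ X) (h : IsFull X) {c : Fin n → ℝ} (hc : c ≠ 0) :
    ∃ p, ∑ i, (c i : ℂ) * delForm X p 1 i ≠ 0 := by
  by_contra! h0
  let L : (Fin n → ℝ) →L[ℝ] ℝ :=
    ∑ i, c i • ContinuousLinearMap.proj (R := ℝ) (φ := fun _ : Fin n => ℝ) i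
  have hL : ∀ i, L (Pi.single i 1) = c i := by
    intro i
    simp [L, Pi.single_apply]
  have hd : ∀ p, MDifferentiableAt 𝓘(ℝ, ℂ) 𝓘(ℝ, Fin n → ℝ) X p :=
    fun p => hX.mdifferentiableAt (by simp)
  have hconst : ∀ p q, L (X p) = L (X q) := by
    refine eq_of_realDeriv_eq_zero (f := fun p => L (X p)) (fun p => ?_) (fun p v => ?_)
    · exact (HasMFDerivAt.comp p L.hasMFDerivAt (hd p).hasMFDerivAt).mdifferentiableAt
    · rw [realDeriv_clm_comp L (hd p), ← surfaceDiff_eq_realDeriv, continuousLinearMap_surfaceDiff]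
      simp [hL, h0]
  obtain ⟨p₀⟩ := (inferInstance : Nonempty M)
  have hL0 : (L : (Fin n → ℝ) →ₗ[ℝ] ℝ) ≠ 0 := by
    intro h1
    apply hc
    funext i
    rw [← hL i]
    exact DFunLike.congr_fun h1 _
  refine h (AffineSubspace.mk' (X p₀) (LinearMap.ker (L : (Fin n → ℝ) →ₗ[ℝ] ℝ))) ?_ fun p => ?_
  · rw [AffineSubspace.direction_mk', Module.Dual.finrank_ker_add_one_of_ne_zero hL0]
    simp
  · rw [AffineSubspace.mem_mk']
    simp [hconst p p₀]

/-- A direction space of codimension one lies in the kernel of a nonzero real functional. This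
functional is constant along X, so its coefficients give a real relation on ∂X. -/
theorem isFull_of_sum_ne_zero [ConnectedSpace M] {X : M → Fin n → ℝ}
    (hX : ContMDiff 𝓘(ℝ, ℂ) 𝓘(ℝ, Fin n → ℝ) ∞ X)
    (h : ∀ c : Fin n → ℝ, c ≠ 0 → ∃ p, ∑ i, (c i : ℂ) * delForm X p 1 i ≠ 0) : IsFull X := by
  intro E hE hXE
  have hlt : E.direction < ⊤ := by
    refine lt_top_iff_ne_top.2 fun h1 => ?_
    rw [h1] at hE
    simp at hE
  obtain ⟨f, hf, hfE⟩ := Submodule.exists_dual_map_eq_bot_of_lt_top hlt inferInstance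
  let L : (Fin n → ℝ) →L[ℝ] ℝ := LinearMap.toContinuousLinearMap f
  obtain ⟨p, hp⟩ := h (fun i => L (Pi.single i 1)) (by
    intro h1
    apply hf
    refine LinearMap.pi_ext' fun i => LinearMap.ext_ring ?_
    exact congrFun h1 i)
  apply hp
  have hconst : (fun q => L (X q)) = fun _ => L (X p) := by
    funext q
    have h1 : X q - X p ∈ E.direction := AffineSubspace.vsub_mem_direction (hXE q) (hXE p)
    have h2 : f (X q - X p) = 0 := by
      have := Submodule.mem_map_of_mem (f := f) h1
      rwa [hfE, Submodule.mem_bot] at this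
    rw [map_sub, sub_eq_zero] at h2
    exact h2
  have h3 : ∀ v, L (surfaceDiff X p v) = 0 := by
    intro v
    rw [surfaceDiff_eq_realDeriv, ← realDeriv_clm_comp L (hX.mdifferentiableAt (by simp)), hconst]
    unfold realDeriv
    rw [mfderiv_const]
    rfl
  have h4 := h3 1
  have h5 := h3 Complex.I
  rw [continuousLinearMap_surfaceDiff] at h4 h5
  apply Complex.ext
  · simpa using h4
  · simpa using h5

/-- The function `delForm X p 1` need not be continuous in p, because the vector 1 refers to a
varying chart. In a fixed chart it changes by a nonzero factor, which does not affect the zero set.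
-/
theorem isClosed_sum_delForm_eq_zero [IsManifold 𝓘(ℂ) ω M] {X : M → Fin n → ℝ}
    (hX : ContMDiff 𝓘(ℝ, ℂ) 𝓘(ℝ, Fin n → ℝ) ∞ X) (c : Fin n → ℂ) :
    IsClosed {p | ∑ i, c i * delForm X p 1 i = 0} := by
  rw [← isOpen_compl_iff, isOpen_iff_mem_nhds]
  intro p hp
  set e := chartAt ℂ p
  have he : e ∈ atlas ℂ M := chart_mem_atlas ℂ p
  have hps : p ∈ e.source := mem_chart_source ℂ p
  let D : ℂ → Fin n → ℂ := fun z i => ((fderiv ℝ (X ∘ e.symm) z 1 i : ℂ) -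
    Complex.I * (fderiv ℝ (X ∘ e.symm) z Complex.I i : ℂ)) / 2
  have hD : ∀ q ∈ e.source, ∑ i, c i * D (e q) i =
      chartFactor e (e q) * ∑ i, c i * delForm X q 1 i := by
    intro q hq
    rw [Finset.mul_sum]
    refine Finset.sum_congr rfl fun i _ => ?_
    have h1 : D (e q) i = chartFactor e (e q) * delForm X q 1 i := by
      rw [← delForm_eq_mul]
      have hq' := e.map_source hq
      have hd : MDifferentiableAt 𝓘(ℝ, ℂ) 𝓘(ℝ, Fin n → ℝ) X (e.symm (e q)) :=
        hX.mdifferentiableAt (by simp)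
      simp only [D, ← realDeriv_chartFactor_mul he hq' hd]
      unfold delForm
      rw [e.left_inv hq, mul_one, mul_comm (chartFactor e (e q)) Complex.I]
      rfl
    rw [h1]
    ring
  have hcont : ContinuousAt (fun q => ∑ i, c i * D (e q) i) p := by
    have h1 : ContinuousAt (fderiv ℝ (X ∘ e.symm)) (e p) := by
      refine (ContDiffAt.fderiv_right (m := 0) (ContMDiffAt.comp_chart_symm he
        (e.map_source hps) hX.contMDiffAt) ?_).continuousAt
      simp
    have h2 : ∀ v : ℂ, ∀ i, ContinuousAt (fun q => fderiv ℝ (X ∘ e.symm) (e q) v i) p := by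
      intro v i
      have h3 : ContinuousAt (fun q => fderiv ℝ (X ∘ e.symm) (e q)) p :=
        ContinuousAt.comp h1 (e.continuousAt hps)
      exact (continuous_apply i).continuousAt.comp (h3.clm_apply continuousAt_const)
    refine tendsto_finsetSum _ fun i _ => ?_
    have h4 := Complex.continuous_ofReal.continuousAt.comp (h2 1 i)
    have h5 := Complex.continuous_ofReal.continuousAt.comp (h2 Complex.I i)
    exact continuousAt_const.mul ((h4.sub (continuousAt_const.mul h5)).div_const 2)
  have hne : ∑ i, c i * D (e p) i ≠ 0 := by
    rw [hD p hps]
    exact mul_ne_zero (chartFactor_ne_zero he (e.map_source hps)) hp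
  filter_upwards [hcont.eventually_ne hne, e.open_source.mem_nhds hps] with q hq hqs h0
  apply hq
  rw [hD q hqs]
  exact mul_eq_zero_of_right _ h0

theorem exists_real_relation (v : Fin 3 → ℂ) : ∃ c : Fin 3 → ℝ, c ≠ 0 ∧ ∑ i, (c i : ℂ) * v i = 0 := by
  let f : (Fin 3 → ℝ) →ₗ[ℝ] ℂ := Fintype.linearCombination ℝ v
  have hf : LinearMap.ker f ≠ ⊥ := LinearMap.ker_ne_bot_of_finrank_lt (by
    rw [Complex.finrank_real_complex]; simp)
  obtain ⟨c, hc, hc0⟩ := Submodule.exists_mem_ne_zero_of_ne_bot hf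
  refine ⟨c, hc0, ?_⟩
  rw [LinearMap.mem_ker] at hc
  simpa [f, Fintype.linearCombination_apply] using hc

/-- A minimal surface in `ℝ³` whose `∂X` satisfies a relation `c₀ θ₀ + c₁ θ₁ + μ θ₂ = 0` with real
`c₀`, `c₁`, not both zero, and complex `μ`, lies in a plane. -/
theorem IsMinimalSurface.not_isFull_of_relation [IsManifold 𝓘(ℂ) ω M] [ConnectedSpace M]
    {X : M → Fin 3 → ℝ} (hX : IsMinimalSurface X) {c₀ c₁ : ℝ} {μ : ℂ} (hc : c₀ ^ 2 + c₁ ^ 2 ≠ 0)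
    (h : ∀ p, c₀ * delForm X p 1 0 + c₁ * delForm X p 1 1 + μ * delForm X p 1 2 = 0) :
    ¬ IsFull X := by
  intro hfull
  have hcC : (c₀ : ℂ) ^ 2 + (c₁ : ℂ) ^ 2 ≠ 0 := by exact_mod_cast hc
  -- Put ℓ = c₀θ₀ + c₁θ₁ = -μθ₂ and m = c₀θ₁ - c₁θ₀. Then (c₀² + c₁²)(θ₀² + θ₁²) = ℓ² + m², so
  -- conformality reads m² = δ²θ₂² for this δ.
  obtain ⟨δ, hδ⟩ := IsAlgClosed.exists_pow_nat_eq (-(μ ^ 2 + (c₀ ^ 2 + c₁ ^ 2))) (n := 2) (by simp)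
  have hQ : ∀ p, delForm X p 1 0 ^ 2 + delForm X p 1 1 ^ 2 + delForm X p 1 2 ^ 2 = 0 := by
    intro p
    have := delSq_eq_zero hX p
    simpa [delSq, Fin.sum_univ_three, euclideanSign] using this
  have hnz : ∀ p, delForm X p 1 0 = 0 → delForm X p 1 1 = 0 → delForm X p 1 2 = 0 → False := by
    intro p h0 h1 h2
    have := delNormSq_pos hX p
    simp [delNormSq, Fin.sum_univ_three, h0, h1, h2] at this
  have hs : ∀ p, (c₀ * delForm X p 1 1 - c₁ * delForm X p 1 0 - δ * delForm X p 1 2) *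
      (c₀ * delForm X p 1 1 - c₁ * delForm X p 1 0 + δ * delForm X p 1 2) = 0 := by
    intro p
    linear_combination (c₀ ^ 2 + c₁ ^ 2 : ℂ) * hQ p - delForm X p 1 2 ^ 2 * hδ -
      (c₀ * delForm X p 1 0 + c₁ * delForm X p 1 1 - μ * delForm X p 1 2) * h p
  -- A second relation with constant d makes θ a multiple of a fixed vector in ℂ³. Its three entries
  -- are linearly dependent over ℝ, which contradicts fullness.
  have key : ∀ d : ℂ, ¬ ∀ p, c₀ * delForm X p 1 1 - c₁ * delForm X p 1 0 + d * delForm X p 1 2 = 0 := by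
    intro d hd
    obtain ⟨c, hc0, hcv⟩ := exists_real_relation
      ![(-c₀ * μ + c₁ * d) / (c₀ ^ 2 + c₁ ^ 2), (-c₁ * μ - c₀ * d) / (c₀ ^ 2 + c₁ ^ 2), 1]
    obtain ⟨p, hp⟩ := hfull.sum_ne_zero hX.smooth hc0
    apply hp
    simp only [Fin.sum_univ_three, Matrix.cons_val_zero, Matrix.cons_val_one,
      Matrix.cons_val] at hcv ⊢
    have h0 : delForm X p 1 0 = (-c₀ * μ + c₁ * d) / (c₀ ^ 2 + c₁ ^ 2) * delForm X p 1 2 := by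
      field_simp
      linear_combination c₀ * h p - c₁ * hd p
    have h1 : delForm X p 1 1 = (-c₁ * μ - c₀ * d) / (c₀ ^ 2 + c₁ ^ 2) * delForm X p 1 2 := by
      field_simp
      linear_combination c₁ * h p + c₀ * hd p
    rw [h0, h1]
    linear_combination delForm X p 1 2 * hcv
  have hclosed : ∀ d : ℂ, IsClosed
      {p | c₀ * delForm X p 1 1 - c₁ * delForm X p 1 0 + d * delForm X p 1 2 = 0} := by
    intro d
    have := isClosed_sum_delForm_eq_zero hX.smooth ![-(c₁ : ℂ), c₀, d]
    convert this using 1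
    ext p
    simp only [Set.mem_ofPred_eq, Fin.sum_univ_three, Matrix.cons_val_zero, Matrix.cons_val_one,
      Matrix.cons_val]
    constructor <;> intro h1 <;> linear_combination h1
  by_cases hδ0 : δ = 0
  · refine key 0 fun p => ?_
    have := hs p
    simpa [hδ0] using this
  -- For δ ≠ 0 the loci m = -δθ₂ and m = δθ₂ are disjoint, since a common point would have θ = 0.
  -- They are closed and cover M, so connectedness selects one of them; no identity theorem is
  -- needed.
  have hcompl : {p | c₀ * delForm X p 1 1 - c₁ * delForm X p 1 0 + δ * delForm X p 1 2 = 0}ᶜ =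
      {p | c₀ * delForm X p 1 1 - c₁ * delForm X p 1 0 + (-δ) * delForm X p 1 2 = 0} := by
    ext p
    simp only [Set.mem_compl_iff, Set.mem_ofPred_eq]
    constructor
    · intro h1
      have := (mul_eq_zero.1 (hs p)).resolve_right h1
      linear_combination this
    · intro h1 h2
      have h3 : delForm X p 1 2 = 0 := by
        have : δ * delForm X p 1 2 = 0 := by linear_combination (h2 - h1) / 2
        exact (mul_eq_zero.1 this).resolve_left hδ0
      have h4 := h p
      rw [h3] at h2 h4
      refine hnz p ?_ ?_ h3
      · refine (mul_eq_zero.1 (?_ : ((c₀ : ℂ) ^ 2 + (c₁ : ℂ) ^ 2) * _ = 0)).resolve_left hcC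
        linear_combination c₀ * h4 - c₁ * h2
      · refine (mul_eq_zero.1 (?_ : ((c₀ : ℂ) ^ 2 + (c₁ : ℂ) ^ 2) * _ = 0)).resolve_left hcC
        linear_combination c₁ * h4 + c₀ * h2
  have hclopen : IsClopen
      {p | c₀ * delForm X p 1 1 - c₁ * delForm X p 1 0 + δ * delForm X p 1 2 = 0} := by
    refine ⟨hclosed δ, ?_⟩
    rw [← isClosed_compl_iff, hcompl]
    exact hclosed (-δ)
  rcases isClopen_iff.1 hclopen with h1 | h1
  · rw [h1, Set.compl_empty] at hcompl
    exact key (-δ) fun p => (Set.ext_iff.1 hcompl p).1 trivial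
  · exact key δ fun p => (Set.ext_iff.1 h1 p).2 trivial

end Full

/-! ### The Riemann sphere and the Gauss maps -/

section Sphere

theorem sphereRatio_zero_right (u : ℂ) : sphereRatio u 0 = OnePoint.infty := by
  simp [sphereRatio]

theorem sphereRatio_of_ne_zero (u : ℂ) {v : ℂ} (hv : v ≠ 0) :
    sphereRatio u v = ((u / v : ℂ) : OnePoint ℂ) := by
  simp [sphereRatio, hv]

theorem sphereDiv_infty (c : ℂ) : sphereDiv c OnePoint.infty = ((0 : ℂ) : OnePoint ℂ) := rfl

theorem sphereDiv_coe (c w : ℂ) : sphereDiv c (w : OnePoint ℂ) = sphereRatio c w := rfl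

theorem continuous_sphereDiv {c : ℂ} (hc : c ≠ 0) : Continuous (sphereDiv c) := by
  rw [continuous_iff_continuousAt]
  intro a
  induction a using OnePoint.rec with
  | infty =>
    rw [OnePoint.continuousAt_infty', coclosedCompact_eq_cocompact, ← Metric.cobounded_eq_cocompact]
    have h1 : Tendsto (fun w : ℂ => c / w) (Bornology.cobounded ℂ) (𝓝 0) := by
      simpa [div_eq_mul_inv] using (tendsto_inv₀_cobounded (α := ℂ)).const_mul c
    have h2 := (OnePoint.continuous_coe.tendsto (0 : ℂ)).comp h1
    refine h2.congr' ?_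
    filter_upwards [Bornology.eventually_ne_cobounded (0 : ℂ)] with w hw
    exact (sphereRatio_of_ne_zero c hw).symm
  | coe w =>
    rw [OnePoint.continuousAt_coe]
    by_cases hw : w = 0
    · subst hw
      rw [continuousAt_iff_punctured_nhds]
      change Tendsto _ _ (𝓝 (sphereRatio c 0))
      rw [sphereRatio_zero_right]
      have h1 : Tendsto (fun w : ℂ => c / w) (𝓝[≠] 0) (Bornology.cobounded ℂ) := by
        simp only [div_eq_mul_inv]
        exact (tendsto_mul_left_cobounded hc).comp tendsto_inv₀_nhdsNE_zero
      rw [Metric.cobounded_eq_cocompact, ← coclosedCompact_eq_cocompact] at h1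
      refine (OnePoint.tendsto_coe_infty.comp h1).congr' ?_
      filter_upwards [self_mem_nhdsWithin] with x hx
      exact (sphereRatio_of_ne_zero c hx).symm
    · have h1 : ContinuousAt (fun x : ℂ => ((c / x : ℂ) : OnePoint ℂ)) w :=
        OnePoint.continuous_coe.continuousAt.comp (continuousAt_const.div continuousAt_id hw)
      refine h1.congr ?_
      filter_upwards [isOpen_ne.mem_nhds hw] with x hx
      exact (sphereRatio_of_ne_zero c hx).symm

theorem continuous_sphereConj : Continuous sphereConj := by
  refine OnePoint.continuous_map Complex.continuous_conj ?_
  rw [coclosedCompact_eq_cocompact]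
  exact Complex.conjLIE.toHomeomorph.isClosedEmbedding.tendsto_cocompact

/-- The points 0 and ∞ are exchanged. At any other point w, equality says |w|²ζ² = -1, which forces
ζ to be purely imaginary. -/
theorem sphereConj_sphereDiv_ne {ζ : ℂ} (hζ : ζ ≠ 0) (hre : ζ.re ≠ 0) (a : RiemannSphere) :
    a ≠ sphereConj (sphereDiv (-1 / ζ ^ 2) a) := by
  induction a using OnePoint.rec with
  | infty =>
    rw [sphereDiv_infty]
    exact (OnePoint.coe_ne_infty _).symm
  | coe w =>
    rw [sphereDiv_coe]
    by_cases hw : w = 0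
    · rw [hw, sphereRatio_zero_right]
      exact OnePoint.coe_ne_infty _
    · rw [sphereRatio_of_ne_zero _ hw]
      intro h
      have h1 : w = (starRingEnd ℂ) (-1 / ζ ^ 2 / w) := OnePoint.coe_injective h
      have h2 : (Complex.normSq w : ℂ) * ζ ^ 2 = -1 := by
        have h3 : (starRingEnd ℂ) w = -1 / ζ ^ 2 / w := by
          rw [h1, Complex.conj_conj, ← h1]
        rw [Complex.normSq_eq_conj_mul_self, h3]
        field_simp
      have hN := Complex.normSq_pos.2 hw
      have him := congrArg Complex.im h2
      have hr := congrArg Complex.re h2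
      simp [pow_two] at him hr
      have h4 : ζ.im = 0 := by
        rcases him with h5 | h5
        · exact absurd h5 hw
        · have : ζ.re * ζ.im = 0 := by linarith
          exact (mul_eq_zero.1 this).resolve_left hre
      rw [h4] at hr
      nlinarith [mul_nonneg hN.le (mul_self_nonneg ζ.re)]

open Classical in
/-- For a rank one matrix `(A, B; C, D)` with row and column ratios `ψ`, `φ`, the condition
`φ ψ = c` means `A = c D`. -/
theorem ratio_eq_sphereDiv_iff {A B C D c : ℂ} (hc : c ≠ 0) (hdet : A * D = B * C)
    (hne : ¬ (A = 0 ∧ B = 0 ∧ C = 0 ∧ D = 0)) :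
    (if C = 0 ∧ D = 0 then sphereRatio A B else sphereRatio C D) =
      sphereDiv c (if B = 0 ∧ D = 0 then sphereRatio A C else sphereRatio B D) ↔ A = c * D := by
  by_cases hD : D = 0
  · subst hD
    simp only [mul_zero, and_true, sphereRatio_zero_right] at hdet hne ⊢
    have hBC := mul_eq_zero.1 hdet.symm
    by_cases hB : B = 0 <;> by_cases hC : C = 0
    · subst hB hC
      have hA : A ≠ 0 := fun h => hne ⟨h, rfl, rfl⟩
      simp [sphereRatio_zero_right, sphereDiv_infty, hA]
    · simp only [hB, hC, if_true, if_false, sphereRatio_of_ne_zero _ hC, sphereDiv_coe]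
      by_cases hA : A = 0
      · simp [hA, sphereRatio_zero_right]
      · have : A / C ≠ 0 := div_ne_zero hA hC
        simp [hA, sphereRatio_of_ne_zero _ this]
    · simp only [hB, hC, if_true, if_false, sphereRatio_of_ne_zero _ hB, sphereDiv_infty]
      rw [OnePoint.coe_eq_coe, div_eq_zero_iff]
      simp [hB]
    · exact absurd hBC (by tauto)
  · simp only [hD, and_false, if_false, sphereRatio_of_ne_zero _ hD, sphereDiv_coe]
    by_cases hB : B = 0
    · subst hB
      have hA : A = 0 := by simpa [hD] using hdet
      subst hA
      simp [sphereRatio_zero_right, hc, hD]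
    · rw [sphereRatio_of_ne_zero _ (div_ne_zero hB hD), OnePoint.coe_eq_coe]
      have hcalc : C / D = c / (B / D) ↔ B * C = c * D * D := by
        field_simp
      rw [hcalc, ← hdet]
      exact ⟨fun h => mul_right_cancel₀ hD h, fun h => by rw [h]⟩

end Sphere

section Gauss

variable {M : Type*} [TopologicalSpace M] [ChartedSpace ℂ M]

/-- The matrix with rows (Θ₄ - Θ₃, Θ₁ + iΘ₂) and (Θ₁ - iΘ₂, Θ₃ + Θ₄) has determinant minus the
complex square, and positivity of the hermitian square makes it nonzero. -/
theorem gaussPsi_eq_sphereDiv_iff {Y : M → Fin 4 → ℝ} {p : M} {c : ℂ} (hc : c ≠ 0)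
    (hQ : delSq lorentzSign Y p = 0) (hN : 0 < delNormSq lorentzSign Y p) :
    gaussPsi Y p = sphereDiv c (gaussPhi Y p) ↔
      delForm Y p 1 3 - delForm Y p 1 2 = c * (delForm Y p 1 2 + delForm Y p 1 3) := by
  refine ratio_eq_sphereDiv_iff hc ?_ ?_
  · simp [delSq, Fin.sum_univ_four, lorentzSign] at hQ
    linear_combination -hQ + delForm Y p 1 1 ^ 2 * Complex.I_sq
  · rintro ⟨hA, hB, hC, hD⟩
    have h0 : delForm Y p 1 0 = 0 := by linear_combination (hB + hC) / 2
    have h1 : delForm Y p 1 1 = 0 := by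
      linear_combination (-Complex.I / 2) * (hB - hC) + delForm Y p 1 1 * Complex.I_sq
    have h2 : delForm Y p 1 2 = 0 := by linear_combination (hD - hA) / 2
    have h3 : delForm Y p 1 3 = 0 := by linear_combination (hD + hA) / 2
    simp [delNormSq, Fin.sum_univ_four, h0, h1, h2, h3] at hN

theorem hasRegularEnds_of_gaussPsi_eq {Y : M → Fin 4 → ℝ} {ζ : ℂ} (hζ : ζ ≠ 0) (hre : ζ.re ≠ 0)
    (h : ∀ p, gaussPsi Y p = sphereDiv (-1 / ζ ^ 2) (gaussPhi Y p)) : HasRegularEnds Y := by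
  intro u a b _ ha hb hab
  have hc : -1 / ζ ^ 2 ≠ 0 := div_ne_zero (by norm_num) (pow_ne_zero 2 hζ)
  have h1 := ((continuous_sphereConj.comp (continuous_sphereDiv hc)).tendsto a).comp ha
  have h2 : b = sphereConj (sphereDiv (-1 / ζ ^ 2) a) := by
    refine tendsto_nhds_unique hb (h1.congr fun k => ?_)
    simp [h]
  exact sphereConj_sphereDiv_ne hζ hre a (hab.trans h2)

end Gauss

/-! ### Primitives of the components of `∂X` -/

section Primitive

variable {M : Type*} [TopologicalSpace M] [ChartedSpace ℂ M] {n : ℕ}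

/-- `F` is a primitive of the `i`-th component of `∂X` on the open set `U`. -/
structure IsPrimitiveOn (X : M → Fin n → ℝ) (i : Fin n) (U : Set M) (F : M → ℂ) : Prop where
  isOpen : IsOpen U
  smooth : ContMDiffOn 𝓘(ℝ, ℂ) 𝓘(ℝ, ℂ) ∞ F U
  deriv : ∀ q ∈ U, ∀ v, realDeriv F q v = delForm X q v i

variable {X : M → Fin n → ℝ} {i : Fin n}

theorem IsPrimitiveOn.contMDiffAt {U : Set M} {F : M → ℂ} (hF : IsPrimitiveOn X i U F) {q : M}
    (hq : q ∈ U) : ContMDiffAt 𝓘(ℝ, ℂ) 𝓘(ℝ, ℂ) ∞ F q :=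
  hF.smooth.contMDiffAt (hF.isOpen.mem_nhds hq)

theorem IsPrimitiveOn.hasDerivAt {U : Set M} {F : M → ℂ} (hF : IsPrimitiveOn X i U F) {γ : ℝ → M}
    {t : ℝ} (hγ : MDifferentiableAt 𝓘(ℝ, ℝ) 𝓘(ℝ, ℂ) γ t) (ht : γ t ∈ U) :
    HasDerivAt (F ∘ γ) (delForm X (γ t) (velocity γ t) i) t := by
  have h1 := ((hF.contMDiffAt ht).mdifferentiableAt (by simp)).hasMFDerivAt
  let D : ℝ →L[ℝ] ℂ := mfderiv 𝓘(ℝ, ℝ) 𝓘(ℝ, ℂ) γ t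
  have h2 : HasFDerivAt (F ∘ γ) ((realDeriv F (γ t)).comp D) t :=
    hasMFDerivAt_iff_hasFDerivAt.1 (HasMFDerivAt.comp t h1 hγ.hasMFDerivAt)
  rw [← hF.deriv _ ht]
  exact h2.hasDerivAt

theorem IsPrimitiveOn.integral_delForm_velocity {U : Set M} {F : M → ℂ}
    (hF : IsPrimitiveOn X i U F) {γ : ℝ → M} {a b : ℝ} (hab : a ≤ b)
    (hγ : ContMDiffOn 𝓘(ℝ, ℝ) 𝓘(ℝ, ℂ) 1 γ (Set.Icc a b)) (hU : Set.MapsTo γ (Set.Icc a b) U) :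
    IntervalIntegrable (fun t => delForm X (γ t) (velocity γ t) i) volume a b ∧
      ∫ t in a..b, delForm X (γ t) (velocity γ t) i = F (γ b) - F (γ a) := by
  rcases hab.eq_or_lt with rfl | hlt
  · simp
  have hg : ContDiffOn ℝ 1 (F ∘ γ) (Set.Icc a b) := by
    rw [← contMDiffOn_iff_contDiffOn]
    exact (hF.smooth.of_le ENat.LEInfty.out).comp hγ hU
  -- Only interior points count: `velocity` is a two-sided derivative and may be meaningless at the
  -- corners of the curve.
  have hd : ∀ t ∈ Set.Ioo a b,
      HasDerivAt (F ∘ γ) (delForm X (γ t) (velocity γ t) i) t := by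
    intro t ht
    have hn : Set.Icc a b ∈ 𝓝 t := Icc_mem_nhds ht.1 ht.2
    exact hF.hasDerivAt ((hγ.contMDiffAt hn).mdifferentiableAt (by simp))
      (hU (Set.Ioo_subset_Icc_self ht))
  have hc : ContinuousOn (derivWithin (F ∘ γ) (Set.Icc a b)) (Set.Icc a b) :=
    hg.continuousOn_derivWithin (uniqueDiffOn_Icc hlt) le_rfl
  have hi : IntervalIntegrable (fun t => delForm X (γ t) (velocity γ t) i) volume a b := by
    refine (hc.intervalIntegrable_of_Icc hab).congr_uIoo fun t ht => ?_
    rw [Set.uIoo_of_le hab] at ht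
    rw [derivWithin_of_mem_nhds (Icc_mem_nhds ht.1 ht.2)]
    exact (hd t ht).deriv
  exact ⟨hi, intervalIntegral.integral_eq_sub_of_hasDerivAt_of_le hab hg.continuousOn hd hi⟩

/-- A form with a global primitive has no periods. -/
theorem IsPrimitiveOn.integral_loop_eq_zero {F : M → ℂ} (hF : IsPrimitiveOn X i Set.univ F)
    {γ : ℝ → M} (hγ : IsPiecewiseC1Loop γ) :
    ∫ t in (0 : ℝ)..1, delForm X (γ t) (velocity γ t) i = 0 := by
  obtain ⟨h01, N, τ, hτ, h0, h1, hC⟩ := hγ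
  have h := fun k (hk : k < N) => hF.integral_delForm_velocity (hτ k.le_succ) (hC k hk)
    (fun _ _ => Set.mem_univ _)
  rw [← h0, ← h1, ← intervalIntegral.sum_integral_adjacent_intervals fun k hk => (h k hk).1,
    Finset.sum_congr rfl fun k hk => (h k (Finset.mem_range.1 hk)).2,
    Finset.sum_range_sub (fun k => F (γ (τ k))), h0, h1, h01, sub_self]

/-- Analytic continuation of primitives of the `i`-th component of `∂X` along one smooth arc. -/
def PrimitiveStep (X : M → Fin n → ℝ) (i : Fin n) (a b : M × ℂ) : Prop :=
  ∃ (U : Set M) (F : M → ℂ) (σ : ℝ → M), IsPrimitiveOn X i U F ∧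
    ContMDiffOn 𝓘(ℝ, ℝ) 𝓘(ℝ, ℂ) 1 σ (Set.Icc 0 1) ∧ Set.MapsTo σ (Set.Icc 0 1) U ∧
    σ 0 = a.1 ∧ σ 1 = b.1 ∧ b.2 - a.2 = F b.1 - F a.1

theorem PrimitiveStep.symm {a b : M × ℂ} (h : PrimitiveStep X i a b) : PrimitiveStep X i b a := by
  obtain ⟨U, F, σ, hF, hσ, hU, h0, h1, hw⟩ := h
  have hm : Set.MapsTo (fun t : ℝ => 1 - t) (Set.Icc 0 1) (Set.Icc 0 1) :=
    fun t ht => ⟨by linarith [ht.2], by linarith [ht.1]⟩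
  refine ⟨U, F, fun t => σ (1 - t), hF, hσ.comp ?_ hm, hU.comp hm, by simpa, by simpa, ?_⟩
  · exact (contDiff_const.sub contDiff_id).contMDiff.contMDiffOn
  · linear_combination -hw

/-- Chains of steps are continuations along piecewise smooth curves. -/
theorem exists_curve_of_primitiveChain {a b : M × ℂ}
    (h : Relation.ReflTransGen (PrimitiveStep X i) a b) :
    ∃ (N : ℕ) (γ : ℝ → M) (d : ℕ → ℂ), γ 0 = a.1 ∧ γ N = b.1 ∧
      b.2 = a.2 + ∑ k ∈ Finset.range N, d k ∧
      ∀ k < N, ContMDiffOn 𝓘(ℝ, ℝ) 𝓘(ℝ, ℂ) 1 γ (Set.Icc k (k + 1)) ∧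
        ∃ (U : Set M) (F : M → ℂ), IsPrimitiveOn X i U F ∧ Set.MapsTo γ (Set.Icc k (k + 1)) U ∧
          F (γ (k + 1)) - F (γ k) = d k := by
  induction h with
  | refl => exact ⟨0, fun _ => a.1, fun _ => 0, rfl, rfl, by simp, by simp⟩
  | @tail b c _ hbc ih =>
    obtain ⟨N, γ, d, h0, hN, hb, hk⟩ := ih
    obtain ⟨U, F, σ, hF, hσ, hU, hσ0, hσ1, hw⟩ := hbc
    let γ' : ℝ → M := fun t => if t ≤ N then γ t else σ (t - N)
    have hle : ∀ t : ℝ, t ≤ N → γ' t = γ t := fun t ht => if_pos ht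
    have hge : ∀ t : ℝ, N ≤ t → γ' t = σ (t - N) := by
      intro t ht
      rcases ht.eq_or_lt with rfl | hlt
      · rw [hle _ le_rfl, hN, sub_self, hσ0]
      · exact if_neg hlt.not_ge
    refine ⟨N + 1, γ', fun k => if k < N then d k else c.2 - b.2, ?_, ?_, ?_, ?_⟩
    · rw [hle 0 N.cast_nonneg, h0]
    · rw [hge _ (by push_cast; linarith)]
      push_cast
      simpa using hσ1
    · rw [Finset.sum_range_succ, Finset.sum_congr rfl fun k hk' => if_pos (Finset.mem_range.1 hk')]
      rw [if_neg (lt_irrefl N)]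
      linear_combination hb
    · intro k hkN
      rcases Nat.lt_succ_iff_lt_or_eq.1 hkN with hlt | rfl
      · obtain ⟨hC, V, G, hG, hV, hd⟩ := hk k hlt
        have hkN' : (k : ℝ) + 1 ≤ N := by exact_mod_cast hlt
        have heq : Set.EqOn γ' γ (Set.Icc k (k + 1)) := fun t ht => hle t (ht.2.trans hkN')
        refine ⟨hC.congr heq, V, G, hG, fun t ht => ?_, ?_⟩
        · rw [heq ht]
          exact hV ht
        · rw [hle _ hkN', hle _ (by linarith), hd]
          exact (if_pos hlt).symm
      · have hm : Set.MapsTo (fun t : ℝ => t - k) (Set.Icc k (k + 1)) (Set.Icc 0 1) :=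
          fun t ht => ⟨by linarith [ht.1], by linarith [ht.2]⟩
        have heq : Set.EqOn γ' (fun t => σ (t - k)) (Set.Icc k (k + 1)) := fun t ht => hge t ht.1
        refine ⟨(hσ.comp ?_ hm).congr heq, U, F, hF, fun t ht => ?_, ?_⟩
        · exact (contDiff_id.sub contDiff_const).contMDiff.contMDiffOn
        · rw [heq ht]
          exact hU (hm ht)
        · rw [hge _ (by linarith), hge _ le_rfl]
          simp [hσ0, hσ1, hw]

/-- A chain returning to its starting point traces a loop on [0, N]. Rescaled to [0, 1], the loop
has as its period the total increment of the continued primitive. -/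
theorem eq_of_primitiveChain
    (hper : ∀ γ : ℝ → M, IsPiecewiseC1Loop γ →
      ∫ t in (0 : ℝ)..1, delForm X (γ t) (velocity γ t) i = 0)
    {p : M} {w w' : ℂ} (h : Relation.ReflTransGen (PrimitiveStep X i) (p, w) (p, w')) : w = w' := by
  obtain ⟨N, γ, d, h0, hN, hw, hk⟩ := exists_curve_of_primitiveChain h
  rcases N.eq_zero_or_pos with rfl | hpos
  · simpa using hw.symm
  have hN0 : (0 : ℝ) < N := by exact_mod_cast hpos
  let τ : ℕ → ℝ := fun k => k / N
  have hτ : Monotone τ := fun k l hkl => by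
    have : (k : ℝ) ≤ l := by exact_mod_cast hkl
    exact div_le_div_of_nonneg_right this hN0.le
  have hm : ∀ k : ℕ, Set.MapsTo (fun t : ℝ => N * t) (Set.Icc (τ k) (τ (k + 1)))
      (Set.Icc k (k + 1)) := by
    intro k t ht
    have h1 := (div_le_iff₀' hN0).1 ht.1
    have h2 := (le_div_iff₀' hN0).1 ht.2
    push_cast at h2
    exact ⟨h1, h2⟩
  have hC : ∀ k < N, ContMDiffOn 𝓘(ℝ, ℝ) 𝓘(ℝ, ℂ) 1 (fun t => γ (N * t))
      (Set.Icc (τ k) (τ (k + 1))) := fun k hkN =>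
    (hk k hkN).1.comp (contDiff_const.mul contDiff_id).contMDiff.contMDiffOn (hm k)
  have hτ0 : τ 0 = 0 := by simp [τ]
  have hτN : τ N = 1 := div_self hN0.ne'
  have hint := hper (fun t => γ (N * t)) ⟨by simp [h0, hN], N, τ, hτ, hτ0, hτN, hC⟩
  have hpiece : ∀ k < N, IntervalIntegrable
      (fun t => delForm X (γ (N * t)) (velocity (fun t => γ (N * t)) t) i) volume
        (τ k) (τ (k + 1)) ∧
      ∫ t in (τ k)..(τ (k + 1)), delForm X (γ (N * t)) (velocity (fun t => γ (N * t)) t) i =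
        d k := by
    intro k hkN
    obtain ⟨-, U, F, hF, hU, hd⟩ := hk k hkN
    have h1 := hF.integral_delForm_velocity (hτ k.le_succ) (hC k hkN) (hU.comp (hm k))
    have e1 : (N : ℝ) * τ k = k := mul_div_cancel₀ _ hN0.ne'
    have e2 : (N : ℝ) * τ (k + 1) = k + 1 := by
      have := mul_div_cancel₀ ((k + 1 : ℕ) : ℝ) hN0.ne'
      push_cast at this
      simpa [τ] using this
    rw [e1, e2, hd] at h1
    exact h1
  rw [← hτ0, ← hτN, ← intervalIntegral.sum_integral_adjacent_intervals
    fun k hkN => (hpiece k hkN).1,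
    Finset.sum_congr rfl fun k hkN => (hpiece k (Finset.mem_range.1 hkN)).2] at hint
  simpa [hint] using hw.symm

end Primitive

/-! ### Local and global existence of primitives -/

section Existence

open Laplacian InnerProductSpace

variable {M : Type*} [TopologicalSpace M] [ChartedSpace ℂ M] [IsManifold 𝓘(ℂ) ω M] {n : ℕ}
  {ε : Fin n → ℝ} {X : M → Fin n → ℝ}

/-- On a coordinate ball the harmonic function X i is Re H with H holomorphic, and H/2 is the
primitive. Segments in the ball supply the arcs used for continuation. -/
theorem IsZeroMeanCurvatureSurface.exists_isPrimitiveOn (hX : IsZeroMeanCurvatureSurface ε X)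
    (i : Fin n) (p : M) : ∃ (U : Set M) (F : M → ℂ), p ∈ U ∧ IsPrimitiveOn X i U F ∧
      ∀ a ∈ U, ∀ b ∈ U, ∃ σ : ℝ → M, ContMDiffOn 𝓘(ℝ, ℝ) 𝓘(ℝ, ℂ) 1 σ (Set.Icc 0 1) ∧
        Set.MapsTo σ (Set.Icc 0 1) U ∧ σ 0 = a ∧ σ 1 = b := by
  have := isManifold_real M
  set e := chartAt ℂ p
  have he : e ∈ atlas ℂ M := chart_mem_atlas ℂ p
  have hem : e ∈ IsManifold.maximalAtlas 𝓘(ℝ, ℂ) ∞ M := IsManifold.subset_maximalAtlas he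
  have hps : p ∈ e.source := mem_chart_source ℂ p
  obtain ⟨r, hr, hB⟩ := Metric.isOpen_iff.1 e.open_target _ (e.map_source hps)
  set B := Metric.ball (e p) r
  have hXi := hX.smooth.component i
  have hharm : HarmonicOnNhd ((fun q => X q i) ∘ e.symm) B := fun z hz =>
    ⟨(ContMDiffAt.comp_chart_symm he (hB hz) hXi.contMDiffAt).of_le ENat.LEInfty.out, by
      filter_upwards [e.open_target.mem_nhds (hB hz)] with x hx
      exact hX.laplacian_eq_zero he hx i⟩
  obtain ⟨H, hH, hHre⟩ := hharm.exists_analyticOnNhd_ball_re_eq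
  have hU : IsOpen (e.source ∩ e ⁻¹' B) := e.isOpen_inter_preimage Metric.isOpen_ball
  have hHs : ContDiffOn ℝ ∞ (fun z => H z / 2) B := fun z hz =>
    ((hH z hz).restrictScalars.contDiffAt.div_const 2).contDiffWithinAt
  have hFs : ContMDiffOn 𝓘(ℝ, ℂ) 𝓘(ℝ, ℂ) ∞ (fun q => H (e q) / 2) (e.source ∩ e ⁻¹' B) :=
    hHs.contMDiffOn.comp ((contMDiffOn_of_mem_maximalAtlas hem).mono Set.inter_subset_left)
      fun q hq => hq.2
  refine ⟨e.source ∩ e ⁻¹' B, fun q => H (e q) / 2, ⟨hps, Metric.mem_ball_self hr⟩,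
    ⟨hU, hFs, fun q hq v => ?_⟩, fun a ha b hb => ?_⟩
  · obtain ⟨hqs, hqB⟩ := hq
    have hqt := e.map_source hqs
    have hsymm := e.left_inv hqs
    have hBn : B ∈ 𝓝 (e q) := Metric.isOpen_ball.mem_nhds hqB
    have hHd : HasFDerivAt H ((fderiv ℂ H (e q)).restrictScalars ℝ) (e q) :=
      (hH _ hqB).differentiableAt.hasFDerivAt.restrictScalars ℝ
    have hHv : ∀ x, fderiv ℂ H (e q) x = deriv H (e q) * x := by
      intro x
      rw [fderiv_eq_smul_deriv, smul_eq_mul, mul_comm]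
    have h1 : ∀ v, realDeriv (fun q => H (e q) / 2) q v =
        v * (deriv H (e q) * (chartFactor e (e q))⁻¹ / 2) := by
      intro v
      have hd := (hFs.contMDiffAt (hU.mem_nhds ⟨hqs, hqB⟩)).mdifferentiableAt (by simp)
      rw [← hsymm] at hd
      have h2 := realDeriv_eq_fderiv he hqt hd v
      rw [hsymm] at h2
      have h3 : (fun q => H (e q) / 2) ∘ e.symm =ᶠ[𝓝 (e q)] fun z => H z / 2 := by
        filter_upwards [hBn] with z hz
        simp [e.right_inv (hB hz)]
      have h4 : HasFDerivAt (fun z => H z / 2)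
          ((2 : ℂ)⁻¹ • (fderiv ℂ H (e q)).restrictScalars ℝ) (e q) := by
        refine (hHd.const_smul (2 : ℂ)⁻¹).congr_of_eventuallyEq (Eventually.of_forall fun z => ?_)
        simp [div_eq_inv_mul]
      rw [h2, h3.fderiv_eq, h4.fderiv]
      simp [hHv]
      ring
    have h5 : ∀ v, surfaceDiff X q v i =
        2 * (v * (deriv H (e q) * (chartFactor e (e q))⁻¹ / 2)).re := by
      intro v
      rw [surfaceDiff_apply (hX.smooth.mdifferentiableAt (by simp))]
      have hd : MDifferentiableAt 𝓘(ℝ, ℂ) 𝓘(ℝ, ℝ) (fun q => X q i) (e.symm (e q)) :=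
        hXi.mdifferentiableAt (by simp)
      have h2 := realDeriv_eq_fderiv he hqt hd v
      rw [hsymm] at h2
      have h3 : (fun q => X q i) ∘ e.symm =ᶠ[𝓝 (e q)] fun z => (H z).re := by
        filter_upwards [hBn] with z hz
        exact (hHre hz).symm
      have h4 : HasFDerivAt (fun z => (H z).re)
          (Complex.reCLM.comp ((fderiv ℂ H (e q)).restrictScalars ℝ)) (e q) :=
        Complex.reCLM.hasFDerivAt.comp (e q) hHd
      rw [h2, h3.fderiv_eq, h4.fderiv]
      have h6 : v * (deriv H (e q) * (chartFactor e (e q))⁻¹ / 2) =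
          ((1 / 2 : ℝ) : ℂ) * (deriv H (e q) * ((chartFactor e (e q))⁻¹ * v)) := by
        push_cast
        ring
      rw [h6, Complex.re_ofReal_mul]
      simp [hHv]
    rw [h1, delForm_eq_of_re h5]
  · have hline : Set.MapsTo (fun t : ℝ => e a + t • (e b - e a)) (Set.Icc 0 1) B := fun t ht =>
      (convex_ball (e p) r).add_smul_sub_mem ha.2 hb.2 ht
    refine ⟨fun t => e.symm (e a + t • (e b - e a)), ?_, fun t ht => ?_, ?_, ?_⟩
    · refine ((contMDiffOn_symm_of_mem_maximalAtlas hem).of_le ENat.LEInfty.out).comp ?_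
        (hline.mono_right hB)
      exact (contDiff_const.add (contDiff_id.smul contDiff_const)).contMDiff.contMDiffOn
    · have h1 := hline ht
      refine ⟨e.map_target (hB h1), ?_⟩
      rw [Set.mem_preimage, e.right_inv (hB h1)]
      exact h1
    · simp [e.left_inv ha.1]
    · simp [e.left_inv hb.1]

/-- A component of `∂X` without periods has a global primitive. -/
theorem IsZeroMeanCurvatureSurface.exists_isPrimitiveOn_univ [ConnectedSpace M]
    (hX : IsZeroMeanCurvatureSurface ε X) {i : Fin n}
    (hper : ∀ γ : ℝ → M, IsPiecewiseC1Loop γ →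
      ∫ t in (0 : ℝ)..1, delForm X (γ t) (velocity γ t) i = 0) :
    ∃ G : M → ℂ, IsPrimitiveOn X i Set.univ G := by
  obtain ⟨p₀⟩ := (inferInstance : Nonempty M)
  have hstep : ∀ {U : Set M} {F : M → ℂ}, IsPrimitiveOn X i U F →
      (∀ a ∈ U, ∀ b ∈ U, ∃ σ : ℝ → M, ContMDiffOn 𝓘(ℝ, ℝ) 𝓘(ℝ, ℂ) 1 σ (Set.Icc 0 1) ∧
        Set.MapsTo σ (Set.Icc 0 1) U ∧ σ 0 = a ∧ σ 1 = b) →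
      ∀ a ∈ U, ∀ b ∈ U, ∀ w, PrimitiveStep X i (a, w) (b, w + (F b - F a)) := by
    intro U F hF hσ a ha b hb w
    obtain ⟨σ, h1, h2, h3, h4⟩ := hσ a ha b hb
    exact ⟨U, F, σ, hF, h1, h2, h3, h4, by simp⟩
  have hreach : {q | ∃ w, Relation.ReflTransGen (PrimitiveStep X i) (p₀, 0) (q, w)} =
      Set.univ := by
    refine IsClopen.eq_univ ⟨?_, ?_⟩ ⟨p₀, 0, Relation.ReflTransGen.refl⟩
    · rw [← isOpen_compl_iff, isOpen_iff_mem_nhds]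
      intro q hq
      obtain ⟨U, F, hqU, hF, hσ⟩ := hX.exists_isPrimitiveOn i q
      filter_upwards [hF.isOpen.mem_nhds hqU] with q' hq'
      rintro ⟨w, hw⟩
      exact hq ⟨_, hw.tail (hstep hF hσ q' hq' q hqU w)⟩
    · rw [isOpen_iff_mem_nhds]
      rintro q ⟨w, hw⟩
      obtain ⟨U, F, hqU, hF, hσ⟩ := hX.exists_isPrimitiveOn i q
      filter_upwards [hF.isOpen.mem_nhds hqU] with q' hq'
      exact ⟨_, hw.tail (hstep hF hσ q hqU q' hq' w)⟩
  -- G takes the endpoint value of some chain from (p₀, 0). Absence of periods makes this value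
  -- independent of the chain, so G agrees locally with a local primitive up to a constant.
  choose G hG using fun q => (Set.ext_iff.1 hreach q).2 trivial
  have : Std.Symm (PrimitiveStep X i) := ⟨fun _ _ h => h.symm⟩
  have huniq : ∀ q w, Relation.ReflTransGen (PrimitiveStep X i) (p₀, 0) (q, w) → G q = w :=
    fun q w hw => eq_of_primitiveChain hper
      ((symm_of _ (hG q)).trans hw)
  have hloc : ∀ q, ∃ (U : Set M) (F : M → ℂ), q ∈ U ∧ IsPrimitiveOn X i U F ∧
      G =ᶠ[𝓝 q] fun q' => F q' + (G q - F q) := by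
    intro q
    obtain ⟨U, F, hqU, hF, hσ⟩ := hX.exists_isPrimitiveOn i q
    refine ⟨U, F, hqU, hF, ?_⟩
    filter_upwards [hF.isOpen.mem_nhds hqU] with q' hq'
    rw [huniq q' _ ((hG q).tail (hstep hF hσ q hqU q' hq' (G q)))]
    ring
  refine ⟨G, isOpen_univ, ?_, fun q _ v => ?_⟩
  · rw [contMDiffOn_univ]
    intro q
    obtain ⟨U, F, hqU, hF, hGF⟩ := hloc q
    exact ((hF.contMDiffAt hqU).add contMDiffAt_const).congr_of_eventuallyEq hGF
  · obtain ⟨U, F, hqU, hF, hGF⟩ := hloc q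
    rw [← hF.deriv q hqU v]
    have hFd := ((hF.contMDiffAt hqU).mdifferentiableAt (by simp)).hasMFDerivAt
    have h1 := hFd.add (hasMFDerivAt_const (G q - F q) q)
    have h2 := (h1.congr_of_eventuallyEq hGF).mfderiv
    have h3 := DFunLike.congr_fun h2 v
    refine h3.trans ?_
    exact add_zero _

end Existence

/-! ### Lorentz deformations -/

section Coefficients

variable {ζ : ℂ}

theorem sq_sub_sq_deformation (hζ : ζ ≠ 0) : ((ζ + ζ⁻¹) / 2) ^ 2 - ((ζ - ζ⁻¹) / 2) ^ 2 = 1 := by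
  field_simp
  ring

theorem normSq_sub_normSq_deformation (hζ : ζ ≠ 0) :
    Complex.normSq ((ζ + ζ⁻¹) / 2) - Complex.normSq ((ζ - ζ⁻¹) / 2) =
      2 * (ζ.re ^ 2 / Complex.normSq ζ) - 1 := by
  have hN : Complex.normSq ζ ≠ 0 := (Complex.normSq_pos.2 hζ).ne'
  have h : Complex.normSq ζ = ζ.re * ζ.re + ζ.im * ζ.im := Complex.normSq_apply ζ
  rw [Complex.normSq_apply, Complex.normSq_apply]
  simp only [Complex.div_ofNat_re, Complex.div_ofNat_im, Complex.add_re, Complex.add_im,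
    Complex.sub_re, Complex.sub_im, Complex.inv_re, Complex.inv_im]
  field_simp
  rw [h]
  ring

end Coefficients

section Deformation

open Laplacian InnerProductSpace

variable {M : Type*} [TopologicalSpace M] [ChartedSpace ℂ M] {ζ : ℂ} {X : M → Fin 3 → ℝ}
  {Y : M → Fin 4 → ℝ}

theorem IsLorentzDeformation.delForm_one (h : IsLorentzDeformation ζ X Y) (p : M) :
    delForm Y p 1 0 = delForm X p 1 0 ∧ delForm Y p 1 1 = delForm X p 1 1 ∧
      delForm Y p 1 2 = (ζ + ζ⁻¹) / 2 * delForm X p 1 2 ∧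
      delForm Y p 1 3 = (ζ - ζ⁻¹) / 2 * delForm X p 1 2 := by
  rw [h.2 p 1]
  exact ⟨rfl, rfl, rfl, rfl⟩

theorem isLorentzDeformation_of_delForm_one (hY : ContMDiff 𝓘(ℝ, ℂ) 𝓘(ℝ, Fin 4 → ℝ) ∞ Y)
    (h : ∀ p, delForm Y p 1 0 = delForm X p 1 0 ∧ delForm Y p 1 1 = delForm X p 1 1 ∧
      delForm Y p 1 2 = (ζ + ζ⁻¹) / 2 * delForm X p 1 2 ∧
      delForm Y p 1 3 = (ζ - ζ⁻¹) / 2 * delForm X p 1 2) : IsLorentzDeformation ζ X Y := by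
  refine ⟨hY, fun p v => ?_⟩
  obtain ⟨h0, h1, h2, h3⟩ := h p
  funext i
  rw [delForm_eq_mul Y p v i, delForm_eq_mul X p v 0, delForm_eq_mul X p v 1,
    delForm_eq_mul X p v 2]
  fin_cases i
  · exact congrArg (v * ·) h0
  · exact congrArg (v * ·) h1
  · exact (congrArg (v * ·) h2).trans (mul_left_comm _ _ _)
  · exact (congrArg (v * ·) h3).trans (mul_left_comm _ _ _)

theorem delSq_euclidean (X : M → Fin 3 → ℝ) (p : M) : delSq euclideanSign X p =
    delForm X p 1 0 ^ 2 + delForm X p 1 1 ^ 2 + delForm X p 1 2 ^ 2 := by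
  simp [delSq, Fin.sum_univ_three, euclideanSign]

theorem delSq_lorentz (Y : M → Fin 4 → ℝ) (p : M) : delSq lorentzSign Y p =
    delForm Y p 1 0 ^ 2 + delForm Y p 1 1 ^ 2 + delForm Y p 1 2 ^ 2 - delForm Y p 1 3 ^ 2 := by
  simp [delSq, Fin.sum_univ_four, lorentzSign, sub_eq_add_neg]

theorem delNormSq_euclidean (X : M → Fin 3 → ℝ) (p : M) : delNormSq euclideanSign X p =
    Complex.normSq (delForm X p 1 0) + Complex.normSq (delForm X p 1 1) +
      Complex.normSq (delForm X p 1 2) := by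
  simp [delNormSq, Fin.sum_univ_three, euclideanSign]

theorem delNormSq_lorentz (Y : M → Fin 4 → ℝ) (p : M) : delNormSq lorentzSign Y p =
    Complex.normSq (delForm Y p 1 0) + Complex.normSq (delForm Y p 1 1) +
      Complex.normSq (delForm Y p 1 2) - Complex.normSq (delForm Y p 1 3) := by
  simp [delNormSq, Fin.sum_univ_four, lorentzSign, sub_eq_add_neg]

theorem IsLorentzDeformation.delSq_eq (h : IsLorentzDeformation ζ X Y) (hζ : ζ ≠ 0) (p : M) :
    delSq lorentzSign Y p = delSq euclideanSign X p := by
  obtain ⟨h0, h1, h2, h3⟩ := h.delForm_one p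
  rw [delSq_euclidean, delSq_lorentz, h0, h1, h2, h3]
  linear_combination delForm X p 1 2 ^ 2 * sq_sub_sq_deformation hζ

/-- The induced metric of a Lorentz deformation is bounded below by a multiple of the induced
metric of the minimal surface. -/
theorem IsLorentzDeformation.mul_delNormSq_le (h : IsLorentzDeformation ζ X Y) (hζ : ζ ≠ 0)
    {p : M} (hQ : delSq euclideanSign X p = 0) :
    ζ.re ^ 2 / Complex.normSq ζ * delNormSq euclideanSign X p ≤ delNormSq lorentzSign Y p := by
  obtain ⟨h0, h1, h2, h3⟩ := h.delForm_one p
  rw [delSq_euclidean] at hQ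
  have hT : Complex.normSq (delForm X p 1 2) ≤
      Complex.normSq (delForm X p 1 0) + Complex.normSq (delForm X p 1 1) := by
    have h4 : delForm X p 1 2 ^ 2 = -(delForm X p 1 0 ^ 2 + delForm X p 1 1 ^ 2) := by
      linear_combination hQ
    have h5 := norm_add_le (delForm X p 1 0 ^ 2) (delForm X p 1 1 ^ 2)
    rw [← norm_neg, ← h4, norm_pow, norm_pow, norm_pow] at h5
    simpa only [Complex.normSq_eq_norm_sq] using h5
  have hk : ζ.re ^ 2 / Complex.normSq ζ ≤ 1 := by
    rw [div_le_one (Complex.normSq_pos.2 hζ), Complex.normSq_apply]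
    nlinarith [mul_self_nonneg ζ.im]
  have hab := normSq_sub_normSq_deformation hζ
  rw [delNormSq_euclidean, delNormSq_lorentz, h0, h1, h2, h3, Complex.normSq_mul,
    Complex.normSq_mul]
  -- The difference of the two sides is exactly (1 - k)(|θ₀|² + |θ₁|² - |θ₂|²).
  linear_combination mul_nonneg (sub_nonneg.2 hk) (sub_nonneg.2 hT) -
    Complex.normSq (delForm X p 1 2) * hab

/-- Each coordinate satisfies dYᵢ(v) = dXⱼ(cv) for a complex constant c, so it is harmonic; the
metric bound gives spacelikeness. -/
theorem IsLorentzDeformation.isStationarySurface [IsManifold 𝓘(ℂ) ω M]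
    (h : IsLorentzDeformation ζ X Y) (hX : IsMinimalSurface X) (hζ : ζ ≠ 0) (hre : ζ.re ≠ 0) :
    IsStationarySurface Y := by
  have hQ := delSq_eq_zero hX
  have key : ∀ (i : Fin 4) (j : Fin 3) (c : ℂ),
      (∀ p, delForm Y p 1 i = c * delForm X p 1 j) →
      ∀ e ∈ atlas ℂ M, ∀ z ∈ e.target, Δ ((fun p => Y p i) ∘ e.symm) z = 0 := by
    intro i j c hij e he z hz
    refine laplacian_chart_eq_zero_of_realDeriv_eq (c := c) (h.1.component i)
      (hX.smooth.component j) (fun p v => ?_) he hz (hX.laplacian_eq_zero he hz j)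
    rw [← surfaceDiff_apply (h.1.mdifferentiableAt (by simp)),
      ← surfaceDiff_apply (hX.smooth.mdifferentiableAt (by simp)), surfaceDiff_eq_re,
      surfaceDiff_eq_re, hij]
    ring_nf
  refine isZeroMeanCurvatureSurface_of_delForm h.1 (fun p => (h.delSq_eq hζ p).trans (hQ p))
    (fun p => lt_of_lt_of_le ?_ (h.mul_delNormSq_le hζ (hQ p))) fun e he z hz i => ?_
  · have h1 := delNormSq_pos hX p
    have h2 := Complex.normSq_pos.2 hζ
    positivity
  · fin_cases i
    · exact key 0 0 1 (fun p => by rw [(h.delForm_one p).1, one_mul]) e he z hz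
    · exact key 1 1 1 (fun p => by rw [(h.delForm_one p).2.1, one_mul]) e he z hz
    · exact key 2 2 _ (fun p => (h.delForm_one p).2.2.1) e he z hz
    · exact key 3 2 _ (fun p => (h.delForm_one p).2.2.2) e he z hz

theorem IsLorentzDeformation.isCompleteSurface (h : IsLorentzDeformation ζ X Y)
    (hQ : ∀ p, delSq euclideanSign X p = 0) (hc : IsCompleteSurface euclideanSign X) (hζ : ζ ≠ 0)
    (hre : ζ.re ≠ 0) : IsCompleteSurface lorentzSign Y := by
  intro γ hγ hlim
  set k := ζ.re ^ 2 / Complex.normSq ζ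
  have hk : 0 < k := by
    have := Complex.normSq_pos.2 hζ
    positivity
  have hle : ∀ p v, √k * √(flatForm euclideanSign (surfaceDiff X p v) (surfaceDiff X p v)) ≤
      √(flatForm lorentzSign (surfaceDiff Y p v) (surfaceDiff Y p v)) := by
    intro p v
    rw [← Real.sqrt_mul hk.le, flatForm_surfaceDiff_self (hQ p),
      flatForm_surfaceDiff_self ((h.delSq_eq hζ p).trans (hQ p))]
    refine Real.sqrt_le_sqrt ?_
    have := mul_le_mul_of_nonneg_left (h.mul_delNormSq_le hζ (hQ p)) (Complex.normSq_nonneg v)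
    linarith
  rw [eq_top_iff]
  calc (⊤ : ENNReal) = ENNReal.ofReal √k * ⊤ :=
        (ENNReal.mul_top (by simpa using Real.sqrt_pos.2 hk)).symm
    _ ≤ _ := by
      rw [← hc γ hγ hlim, ← lintegral_const_mul' _ _ ENNReal.ofReal_ne_top]
      refine lintegral_mono fun t => ?_
      rw [← ENNReal.ofReal_mul (Real.sqrt_nonneg k)]
      exact ENNReal.ofReal_le_ofReal (hle _ _)

theorem IsLorentzDeformation.hasRegularEnds [IsManifold 𝓘(ℂ) ω M]
    (h : IsLorentzDeformation ζ X Y) (hX : IsMinimalSurface X) (hζ : ζ ≠ 0) (hre : ζ.re ≠ 0) :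
    HasRegularEnds Y := by
  have hY := h.isStationarySurface hX hζ hre
  refine hasRegularEnds_of_gaussPsi_eq hζ hre fun p => ?_
  rw [gaussPsi_eq_sphereDiv_iff (div_ne_zero (by norm_num) (pow_ne_zero 2 hζ))
    (delSq_eq_zero hY p) (delNormSq_pos hY p), (h.delForm_one p).2.2.1, (h.delForm_one p).2.2.2]
  field_simp
  ring

theorem IsLorentzDeformation.isFull [IsManifold 𝓘(ℂ) ω M] [ConnectedSpace M]
    (h : IsLorentzDeformation ζ X Y) (hX : IsMinimalSurface X) (hζ : ζ ≠ 0) (hre : ζ.re ≠ 0)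
    (him : ζ.im ≠ 0) (hfull : IsFull X) : IsFull Y := by
  refine isFull_of_sum_ne_zero h.1 fun c hc => ?_
  by_contra! h0
  set μ : ℂ := c 2 * ((ζ + ζ⁻¹) / 2) + c 3 * ((ζ - ζ⁻¹) / 2)
  have hrel : ∀ p, c 0 * delForm X p 1 0 + c 1 * delForm X p 1 1 + μ * delForm X p 1 2 = 0 := by
    intro p
    obtain ⟨h1, h2, h3, h4⟩ := h.delForm_one p
    have := h0 p
    rw [Fin.sum_univ_four, h1, h2, h3, h4] at this
    linear_combination this
  by_cases hc01 : c 0 ^ 2 + c 1 ^ 2 = 0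
  · have hc0 : c 0 = 0 := by nlinarith [sq_nonneg (c 0), sq_nonneg (c 1)]
    have hc1 : c 1 = 0 := by nlinarith [sq_nonneg (c 0), sq_nonneg (c 1)]
    -- Fullness of X in the vertical direction provides a point with θ₂ ≠ 0, where the relation
    -- forces μ = 0.
    obtain ⟨p, hp⟩ := hfull.sum_ne_zero hX.smooth (c := ![0, 0, 1])
      (fun h1 => by simpa using congrFun h1 2)
    have hp2 : delForm X p 1 2 ≠ 0 := by simpa [Fin.sum_univ_three] using hp
    have hμ : μ = 0 := by
      have := hrel p
      simpa [hc0, hc1, hp2] using this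
    -- This is 2ζμ = 0. As ζ² is not real, both real coefficients vanish.
    have h1 : ((c 2 + c 3 : ℝ) : ℂ) * ζ ^ 2 = ((c 3 - c 2 : ℝ) : ℂ) := by
      simp only [μ] at hμ
      field_simp at hμ
      push_cast
      linear_combination hμ
    have h2 := congrArg Complex.im h1
    rw [Complex.im_ofReal_mul, Complex.ofReal_im, pow_two, Complex.mul_im] at h2
    have h3 : c 2 + c 3 = 0 := by
      have h4 : ζ.re * ζ.im + ζ.im * ζ.re ≠ 0 := by
        have := mul_ne_zero hre him
        intro h5
        apply this
        linarith
      exact (mul_eq_zero.1 h2).resolve_right h4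
    rw [h3] at h1
    have h4 : c 3 - c 2 = 0 := by
      have h5 : ((c 3 - c 2 : ℝ) : ℂ) = 0 := by rw [← h1]; simp
      exact_mod_cast h5
    apply hc
    funext i
    fin_cases i
    · exact hc0
    · exact hc1
    · change c 2 = 0
      linarith
    · change c 3 = 0
      linarith
  · exact IsMinimalSurface.not_isFull_of_relation hX hc01 hrel hfull

theorem ContMDiff.re_const_mul {G : M → ℂ} (hG : ContMDiff 𝓘(ℝ, ℂ) 𝓘(ℝ, ℂ) ∞ G) (c : ℂ) :
    ContMDiff 𝓘(ℝ, ℂ) 𝓘(ℝ, ℝ) ∞ (fun p => 2 * (c * G p).re) := by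
  have h : ContDiff ℝ ∞ (fun z : ℂ => 2 * (c * z).re) :=
    contDiff_const.mul (Complex.reCLM.contDiff.comp (contDiff_const.mul contDiff_id))
  exact h.contMDiff.comp hG

theorem realDeriv_re_const_mul {G : M → ℂ} {p : M}
    (hG : MDifferentiableAt 𝓘(ℝ, ℂ) 𝓘(ℝ, ℂ) G p) (c v : ℂ) :
    realDeriv (fun q => 2 * (c * G q).re) p v = 2 * (c * realDeriv G p v).re := by
  simpa using
    realDeriv_clm_comp ((2 : ℝ) • Complex.reCLM.comp (ContinuousLinearMap.mul ℝ ℂ c)) hG v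

theorem IsPrimitiveOn.exists_isLorentzDeformation {G : M → ℂ}
    (hX : ContMDiff 𝓘(ℝ, ℂ) 𝓘(ℝ, Fin 3 → ℝ) ∞ X) (hG : IsPrimitiveOn X 2 Set.univ G) (ζ : ℂ) :
    ∃ Y : M → Fin 4 → ℝ, IsLorentzDeformation ζ X Y := by
  have hGs : ContMDiff 𝓘(ℝ, ℂ) 𝓘(ℝ, ℂ) ∞ G := contMDiffOn_univ.1 hG.smooth
  let Y : M → Fin 4 → ℝ := fun p => ![X p 0, X p 1, 2 * ((ζ + ζ⁻¹) / 2 * G p).re,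
    2 * ((ζ - ζ⁻¹) / 2 * G p).re]
  have hY : ContMDiff 𝓘(ℝ, ℂ) 𝓘(ℝ, Fin 4 → ℝ) ∞ Y := by
    rw [contMDiff_pi_space]
    intro i
    fin_cases i
    · exact hX.component 0
    · exact hX.component 1
    · exact hGs.re_const_mul _
    · exact hGs.re_const_mul _
  have hYd : ∀ p, MDifferentiableAt 𝓘(ℝ, ℂ) 𝓘(ℝ, Fin 4 → ℝ) Y p :=
    fun p => hY.mdifferentiableAt (by simp)
  have hXY : ∀ p (i : Fin 4) (j : Fin 3), (fun q => Y q i) = (fun q => X q j) →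
      delForm Y p 1 i = delForm X p 1 j := by
    intro p i j hij
    rw [delForm_eq_of_re (t := delForm X p 1 j), one_mul]
    intro v
    rw [surfaceDiff_apply (hYd p), hij, ← surfaceDiff_apply (hX.mdifferentiableAt (by simp)),
      surfaceDiff_eq_re]
  have hGY : ∀ p (i : Fin 4) (c : ℂ), (fun q => Y q i) = (fun q => 2 * (c * G q).re) →
      delForm Y p 1 i = c * delForm X p 1 2 := by
    intro p i c hic
    rw [delForm_eq_of_re (t := c * delForm X p 1 2), one_mul]
    intro v
    rw [surfaceDiff_apply (hYd p), hic, realDeriv_re_const_mul (hGs.mdifferentiableAt (by simp)),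
      hG.deriv p trivial, delForm_eq_mul, mul_left_comm]
  exact ⟨Y, isLorentzDeformation_of_delForm_one hY fun p =>
    ⟨hXY p 0 0 rfl, hXY p 1 1 rfl, hGY p 2 _ rfl, hGY p 3 _ rfl⟩⟩

end Deformation

/-! ### Recovering the minimal surface -/

section Converse

open Laplacian InnerProductSpace ComplexConjugate

variable {M : Type*} [TopologicalSpace M] [ChartedSpace ℂ M] {ζ : ℂ}
  {Y : M → Fin 4 → ℝ}

theorem IsStationarySurface.relation_of_gaussPsi_eq (hY : IsStationarySurface Y) (hζ : ζ ≠ 0)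
    (h : ∀ p, gaussPsi Y p = sphereDiv (-1 / ζ ^ 2) (gaussPhi Y p)) (p : M) :
    (1 - ζ ^ 2) * delForm Y p 1 2 + (1 + ζ ^ 2) * delForm Y p 1 3 = 0 := by
  have h1 := (gaussPsi_eq_sphereDiv_iff (div_ne_zero (by norm_num) (pow_ne_zero 2 hζ))
    (delSq_eq_zero hY p) (delNormSq_pos hY p)).1 (h p)
  field_simp at h1
  linear_combination h1

variable [IsManifold 𝓘(ℂ) ω M]

/-- If ζ² = r were real, the relation would have real coefficients 1 - r and 1 + r, which never
vanish together, and Y would lie in a hyperplane. -/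
theorem sq_im_ne_zero_of_relation [ConnectedSpace M] (hY : IsStationarySurface Y)
    (hfull : IsFull Y)
    (h : ∀ p, (1 - ζ ^ 2) * delForm Y p 1 2 + (1 + ζ ^ 2) * delForm Y p 1 3 = 0) :
    (ζ ^ 2).im ≠ 0 := by
  intro him
  have hr : ζ ^ 2 = (((ζ ^ 2).re : ℝ) : ℂ) := Complex.ext rfl (by simpa using him)
  obtain ⟨p, hp⟩ := hfull.sum_ne_zero hY.smooth (c := ![0, 0, 1 - (ζ ^ 2).re, 1 + (ζ ^ 2).re])
    (fun h0 => by
      have h2 : 1 - (ζ ^ 2).re = 0 := congrFun h0 2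
      have h3 : 1 + (ζ ^ 2).re = 0 := congrFun h0 3
      linarith)
  apply hp
  have := h p
  rw [hr] at this
  simpa [Fin.sum_univ_four] using this

theorem exists_minimal_of_relation (hY : IsStationarySurface Y) (hζ : ζ ≠ 0)
    (him : (ζ ^ 2).im ≠ 0)
    (h : ∀ p, (1 - ζ ^ 2) * delForm Y p 1 2 + (1 + ζ ^ 2) * delForm Y p 1 3 = 0) :
    ∃ X : M → Fin 3 → ℝ, IsMinimalSurface X ∧ HasNoVerticalPeriods X ∧
      IsLorentzDeformation ζ X Y := by
  have hab := sq_sub_sq_deformation hζ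
  have hb_eq : (1 - ζ ^ 2) = -2 * ζ * ((ζ - ζ⁻¹) / 2) := by field_simp; ring
  have ha_eq : (1 + ζ ^ 2) = 2 * ζ * ((ζ + ζ⁻¹) / 2) := by field_simp; ring
  have hcζ : conj ζ ≠ 0 := (map_ne_zero _).2 hζ
  -- This quantity is a nonzero multiple of Im ζ²; it is the determinant needed to solve for t dz
  -- from its real parts against a and b.
  have hD : (ζ + ζ⁻¹) / 2 * conj ((ζ - ζ⁻¹) / 2) - (ζ - ζ⁻¹) / 2 * conj ((ζ + ζ⁻¹) / 2) ≠ 0 := by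
    intro h0
    apply him
    rw [← Complex.conj_eq_iff_im]
    simp only [map_div₀, map_sub, map_add, map_inv₀, map_ofNat, map_pow] at h0 ⊢
    field_simp at h0
    linear_combination h0 / 2
  set a := (ζ + ζ⁻¹) / 2
  set b := (ζ - ζ⁻¹) / 2
  have hba : ∀ p, b * delForm Y p 1 2 = a * delForm Y p 1 3 := by
    intro p
    have h1 := h p
    rw [hb_eq, ha_eq] at h1
    have h2 : 2 * ζ * (a * delForm Y p 1 3 - b * delForm Y p 1 2) = 0 := by
      linear_combination h1
    have h3 := (mul_eq_zero.1 h2).resolve_left (mul_ne_zero two_ne_zero hζ)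
    linear_combination -h3
  have ha0 : a ≠ 0 := by
    intro h0
    apply hD
    simp [h0]
  -- Since a² - b² = 1, this combination inverts (Θ₃, Θ₄) = (a t, b t).
  let t : M → ℂ := fun p => a * delForm Y p 1 2 - b * delForm Y p 1 3
  have h2 : ∀ p, delForm Y p 1 2 = a * t p := fun p => by
    linear_combination -delForm Y p 1 2 * hab - b * hba p
  have h3 : ∀ p, delForm Y p 1 3 = b * t p := fun p => by
    linear_combination -delForm Y p 1 3 * hab - a * hba p
  set D := a * conj b - b * conj a
  -- With s = vt, the last two components of dY are as + conj(as) and bs + conj(bs). Weights conj b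
  -- and -conj a cancel conj s and leave D s.
  let L : (Fin 4 → ℝ) →L[ℝ] ℂ :=
    (conj b / D) • Complex.ofRealCLM.comp (ContinuousLinearMap.proj 2) -
      (conj a / D) • Complex.ofRealCLM.comp (ContinuousLinearMap.proj 3)
  let F : M → ℂ := fun p => L (Y p)
  have hYd : ∀ p, MDifferentiableAt 𝓘(ℝ, ℂ) 𝓘(ℝ, Fin 4 → ℝ) Y p :=
    fun p => hY.smooth.mdifferentiableAt (by simp)
  have hF : ContMDiff 𝓘(ℝ, ℂ) 𝓘(ℝ, ℂ) ∞ F := L.contDiff.contMDiff.comp hY.smooth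
  have hFd : ∀ p v, realDeriv F p v = v * t p := by
    intro p v
    have h4 : realDeriv F p v = conj b / D * (surfaceDiff Y p v 2 : ℂ) -
        conj a / D * (surfaceDiff Y p v 3 : ℂ) := realDeriv_clm_comp L (hYd p) v
    have hre : ∀ s : ℂ, ((2 * s.re : ℝ) : ℂ) = s + conj s := fun s => by
      rw [Complex.add_conj]
    rw [h4, surfaceDiff_eq_re, surfaceDiff_eq_re, hre, hre, h2, h3]
    simp only [map_mul]
    field_simp
    simp only [D]
    ring
  let X : M → Fin 3 → ℝ := fun p => ![Y p 0, Y p 1, 2 * (1 * F p).re]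
  have hX : ContMDiff 𝓘(ℝ, ℂ) 𝓘(ℝ, Fin 3 → ℝ) ∞ X := by
    rw [contMDiff_pi_space]
    intro i
    fin_cases i
    · exact hY.smooth.component 0
    · exact hY.smooth.component 1
    · exact hF.re_const_mul 1
  have hXd : ∀ p, MDifferentiableAt 𝓘(ℝ, ℂ) 𝓘(ℝ, Fin 3 → ℝ) X p :=
    fun p => hX.mdifferentiableAt (by simp)
  have hX01 : ∀ p (i : Fin 3) (j : Fin 4), (fun q => X q i) = (fun q => Y q j) →
      delForm X p 1 i = delForm Y p 1 j := by
    intro p i j hij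
    rw [delForm_eq_of_re (t := delForm Y p 1 j), one_mul]
    intro v
    rw [surfaceDiff_apply (hXd p), hij, ← surfaceDiff_apply (hYd p), surfaceDiff_eq_re]
  have hX0 : ∀ p, delForm X p 1 0 = delForm Y p 1 0 := fun p => hX01 p 0 0 rfl
  have hX1 : ∀ p, delForm X p 1 1 = delForm Y p 1 1 := fun p => hX01 p 1 1 rfl
  have hXre : ∀ p v, surfaceDiff X p v 2 = 2 * (v * t p).re := by
    intro p v
    rw [surfaceDiff_apply (hXd p)]
    refine (realDeriv_re_const_mul (hF.mdifferentiableAt (by simp)) 1 v).trans ?_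
    rw [hFd, one_mul]
  have hX2 : ∀ p v, delForm X p v 2 = v * t p := fun p => delForm_eq_of_re (hXre p)
  have hX2' : ∀ p, delForm X p 1 2 = t p := fun p => by rw [hX2, one_mul]
  have hprim : IsPrimitiveOn X 2 Set.univ F :=
    ⟨isOpen_univ, hF.contMDiffOn, fun p _ v => by rw [hFd, hX2]⟩
  have hdef : IsLorentzDeformation ζ X Y :=
    isLorentzDeformation_of_delForm_one hY.smooth fun p =>
      ⟨(hX0 p).symm, (hX1 p).symm, by rw [hX2', h2], by rw [hX2', h3]⟩
  refine ⟨X, isZeroMeanCurvatureSurface_of_delForm hX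
    (fun p => (hdef.delSq_eq hζ p).symm.trans (delSq_eq_zero hY p)) (fun p => ?_)
    fun e he z hz i => ?_, fun γ hγ => hprim.integral_loop_eq_zero hγ, hdef⟩
  · have hpos := delNormSq_pos hY p
    have n0 := Complex.normSq_nonneg (delForm X p 1 0)
    have n1 := Complex.normSq_nonneg (delForm X p 1 1)
    have n2 := Complex.normSq_nonneg (delForm X p 1 2)
    rw [delNormSq_lorentz, h2, h3, ← hX0, ← hX1, ← hX2', Complex.normSq_mul,
      Complex.normSq_mul] at hpos
    rw [delNormSq_euclidean]
    by_contra hle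
    -- If the Euclidean norm of ∂X vanished, all its components would vanish, and with them the
    -- Lorentz norm of ∂Y, which is positive.
    have e0 : Complex.normSq (delForm X p 1 0) = 0 := by linarith
    have e1 : Complex.normSq (delForm X p 1 1) = 0 := by linarith
    have e2 : Complex.normSq (delForm X p 1 2) = 0 := by linarith
    simp [e0, e1, e2] at hpos
  · fin_cases i
    · exact hY.laplacian_eq_zero he hz 0
    · exact hY.laplacian_eq_zero he hz 1
    · refine laplacian_chart_eq_zero_of_realDeriv_eq (c := a⁻¹) (hX.component 2)
        (hY.smooth.component 2) (fun p v => ?_) he hz (hY.laplacian_eq_zero he hz 2)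
      rw [← surfaceDiff_apply (hXd p), ← surfaceDiff_apply (hYd p), hXre, surfaceDiff_eq_re, h2]
      congr 2
      field_simp

end Converse

theorem theorem4p2 {M : Type*} [TopologicalSpace M] [ChartedSpace ℂ M] [IsManifold 𝓘(ℂ) ω M]
    [T2Space M] [ConnectedSpace M] :
    (∀ X : M → Fin 3 → ℝ, IsMinimalSurface X → IsCompleteSurface euclideanSign X →
      HasNoVerticalPeriods X → ∀ ζ : ℂ, ζ ≠ 0 → ζ.re ≠ 0 →
        (∃ Y : M → Fin 4 → ℝ, IsLorentzDeformation ζ X Y) ∧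
        ∀ Y : M → Fin 4 → ℝ, IsLorentzDeformation ζ X Y →
          IsStationarySurface Y ∧ IsCompleteSurface lorentzSign Y ∧ HasRegularEnds Y ∧
          (ζ.im ≠ 0 → IsFull X → IsFull Y)) ∧
    (∀ Y : M → Fin 4 → ℝ, IsStationarySurface Y → IsFull Y → ∀ ζ : ℂ, ζ ≠ 0 →
      (∀ p, gaussPsi Y p = sphereDiv (-1 / ζ ^ 2) (gaussPhi Y p)) →
        ζ.re ≠ 0 ∧ ∃ X : M → Fin 3 → ℝ, IsMinimalSurface X ∧ HasNoVerticalPeriods X ∧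
          IsLorentzDeformation ζ X Y) := by
  refine ⟨fun X hX hc hper ζ hζ hre => ⟨?_, fun Y hY => ?_⟩, fun Y hY hfull ζ hζ h => ?_⟩
  · obtain ⟨G, hG⟩ := hX.exists_isPrimitiveOn_univ hper
    exact hG.exists_isLorentzDeformation hX.smooth ζ
  · exact ⟨hY.isStationarySurface hX hζ hre, hY.isCompleteSurface (delSq_eq_zero hX) hc hζ hre,
      hY.hasRegularEnds hX hζ hre, hY.isFull hX hζ hre⟩
  · have hrel := IsStationarySurface.relation_of_gaussPsi_eq hY hζ h
    have him := sq_im_ne_zero_of_relation hY hfull hrel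
    refine ⟨fun h0 => him ?_, exists_minimal_of_relation hY hζ him hrel⟩
    rw [pow_two, Complex.mul_im, h0]
    ring
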